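/- Let $\mathbb K$ be an algebraically closed field of characteristic $0$ (for instance $\mathbb C$). **Jordan–Kronecker invariants.** For every two linear maps $A,B:U\to V$ between finite-dimensional spaces there are bases of $U$ and $V$ in which the pencil $A+\lambda B$ is block diagonal with blocks of the following kinds: Jordan blocks with eigenvalue $\lambda_0\in\mathbb K$ ($A_i$ is the upper triangular Jordan cell of $\lambda_0$, $B_i$ the identity) or $\infty$ ($A_i$ is the identity, $B_i$ the nilpotent upper triangular Jordan cell); horizontal Kronecker blocks of size $(h-1)\times h$, $h\ge 1$, with $\lambda$ on the diagonal, $1$ directly to its right and $0$ elsewhere; vertical Kronecker blocks of size $v\times(v-1)$, $v\ge1$, the transposes of the horizontal ones. (Blocks of size $0\times1$ and $1\times 0$ make up zero columns and zero rows.) The blocks are unique up to order; the numbers $h$ are the horizontal indices and the numbers $v$ the vertical indices of the pencil. The *algebraic type* of the pencil consists of the horizontal indices, the vertical indices, the number of distinct eigenvalues, and the number and the sizes of the Jordan blocks for each eigenvalue. For a finite-dimensional representation $\rho:\mathfrak g\to\mathrm{gl}(V)$ and $x\in V$ put $R_x:\mathfrak g\to V$, $R_x(\xi)=\rho(\xi)x$.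 The *Jordan–Kronecker (JK) invariants* of $\rho$ are the algebraic type of the pencil $R_x+\lambda R_a$ for a generic pair $(x,a)\in V\times V$, i.e. for all pairs in a nonempty Zariski open subset. **Theorem.** Let $\mathfrak g\subset \mathrm{gl}(n)$ be either $\mathrm{so}(n)$, the Lie algebra of skew-symmetric $n\times n$ matrices, with $\varepsilon=-1$, or, for even $n$, $\mathrm{sp}(n)=\{Y: Y^T\Omega+\Omega Y=0\}$, $\Omega=\begin{pmatrix}0&I_{n/2}\\-I_{n/2}&0\end{pmatrix}$, with $\varepsilon=+1$. Let $\rho$ be the sum of $m$ copies of the standard representation of $\mathfrak g$ on $\mathbb K^n$. 1. Assume $m<n$ and write $m=q(n-m)+r$ with integers $q,r$ and $0\le r<n-m$. Then the JK invariants of $\rho$ are * $\frac{(n-m)(n-m+\varepsilon)}{2}$ horizontal indices, of which $\frac{(n-m-r)(n-m-r+\varepsilon)}{2}$ are equal to $2q+1$, $(n-m-r)r$ are equal to $2q+2$, and $\frac{r(r+\varepsilon)}{2}$ are equal to $2q+3$; * $\frac{m(m-\varepsilon)}{2}$ vertical indices, all equal to $2$. There are no Jordan blocks. 2. Assume $m=n$.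 For $\mathrm{so}(n)$ the JK invariants of $\rho$ are $\frac{n(n+1)}{2}$ vertical indices, of which $n$ are equal to $1$ and $\frac{n(n-1)}{2}$ are equal to $2$; there are no horizontal indices and no Jordan blocks. For $\mathrm{sp}(n)$ they are $\frac{n(n-1)}{2}$ vertical indices equal to $2$ and $n$ Jordan $1\times1$ blocks with pairwise distinct eigenvalues; there are no horizontal indices. 3. Assume $m>n$. Then the JK invariants of $\rho$ are $n(m-n)+\frac{n(n-\varepsilon)}{2}$ vertical indices, of which $(m-n-\varepsilon)n$ are equal to $1$ and $\frac{n(n+\varepsilon)}{2}$ are equal to $2$; there are no horizontal indices and no Jordan blocks. -/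

import Mathlib

namespace JK

/-- The indecomposable blocks `A + t B` of the Jordan–Kronecker normal form of a pair of linear
maps. The numerical parameter `k` of a block is one less than its index:
* `jordan μ k` is a Jordan block of size `(k + 1) × (k + 1)` with eigenvalue `μ`, where
  `μ` is an element of `K` or `∞`;
* `horizontal k` is a horizontal Kronecker block of size `k × (k + 1)`;
* `vertical k` is a vertical Kronecker block of size `(k + 1) × k`.
For `k = 0` the Kronecker blocks are the empty `0 × 1` and `1 × 0` blocks, into which a zero block
of the normal form is divided. -/
inductive Block (K : Type*) where
  | jordan (μ : OnePoint K) (k : ℕ)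
  | horizontal (k : ℕ)
  | vertical (k : ℕ)

namespace Block

variable {K : Type*}

/-- Number of rows of a block. -/
def rows : Block K → ℕ
  | jordan _ k => k + 1
  | horizontal k => k
  | vertical k => k + 1

/-- Number of columns of a block. -/
def cols : Block K → ℕ
  | jordan _ k => k + 1
  | horizontal k => k + 1
  | vertical k => k

/-- The first matrix `A` of a block `A + t B`. -/
def matA [Field K] : (b : Block K) → Matrix (Fin b.rows) (Fin b.cols) K
  | jordan (some μ) k => Matrix.of fun (i j : Fin (k + 1)) =>
      if (j : ℕ) = i then μ else if (j : ℕ) = i + 1 then 1 else 0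
  | jordan none k => (1 : Matrix (Fin (k + 1)) (Fin (k + 1)) K)
  | horizontal k => Matrix.of fun (i : Fin k) (j : Fin (k + 1)) =>
      if (j : ℕ) = i + 1 then 1 else 0
  | vertical k => Matrix.of fun (i : Fin (k + 1)) (j : Fin k) =>
      if (i : ℕ) = j + 1 then 1 else 0

/-- The second matrix `B` of a block `A + t B`. -/
def matB [Field K] : (b : Block K) → Matrix (Fin b.rows) (Fin b.cols) K
  | jordan (some _) k => (1 : Matrix (Fin (k + 1)) (Fin (k + 1)) K)
  | jordan none k => Matrix.of fun (i j : Fin (k + 1)) =>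
      if (j : ℕ) = i + 1 then 1 else 0
  | horizontal k => Matrix.of fun (i : Fin k) (j : Fin (k + 1)) =>
      if (j : ℕ) = i then 1 else 0
  | vertical k => Matrix.of fun (i : Fin (k + 1)) (j : Fin k) =>
      if (i : ℕ) = j then 1 else 0

/-- The horizontal index (the width) of a horizontal block. -/
def horizontalIndex? : Block K → Option ℕ
  | horizontal k => some (k + 1)
  | _ => none

/-- The vertical index (the height) of a vertical block. -/
def verticalIndex? : Block K → Option ℕ
  | vertical k => some (k + 1)
  | _ => none

/-- The eigenvalue of a Jordan block. -/
def eigenvalue? : Block K → Option (OnePoint K)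
  | jordan μ _ => some μ
  | _ => none

open Classical in
/-- The size of a Jordan block with the given eigenvalue. -/
noncomputable def jordanSize? (μ : OnePoint K) : Block K → Option ℕ
  | jordan ν k => if ν = μ then some (k + 1) else none
  | _ => none

end Block

/-- The discrete invariants of a pencil: the multiset that contains, for every distinct eigenvalue,
the multiset of the sizes of the Jordan blocks with this eigenvalue; the multiset of horizontal
indices; the multiset of vertical indices. -/
structure AlgebraicType where
  jordan : Multiset (Multiset ℕ)
  horizontal : Multiset ℕ
  vertical : Multiset ℕ

open Classical in
/-- The algebraic type determined by a multiset of blocks. -/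
noncomputable def typeOfBlocks {K : Type*} (s : Multiset (Block K)) : AlgebraicType where
  jordan := (s.filterMap Block.eigenvalue?).dedup.map fun μ => s.filterMap (Block.jordanSize? μ)
  horizontal := s.filterMap Block.horizontalIndex?
  vertical := s.filterMap Block.verticalIndex?

/-- The pencil `A + t B` of linear maps `U → V` has algebraic type `t`: in some bases of `U` and `V`
both matrices are block diagonal with the blocks of a Jordan–Kronecker normal form, and the
algebraic type given by these blocks is `t`. -/
def HasAlgebraicType {K U V : Type*} [Field K] [AddCommGroup U] [Module K U]
    [AddCommGroup V] [Module K V] (A B : U →ₗ[K] V) (t : AlgebraicType) : Prop :=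
  ∃ (ι : Type) (_ : Fintype ι) (_ : DecidableEq ι) (b : ι → Block K)
    (bU : Module.Basis (Σ i, Fin (b i).cols) K U) (bV : Module.Basis (Σ i, Fin (b i).rows) K V),
    LinearMap.toMatrix bU bV A = Matrix.blockDiagonal' (fun i => (b i).matA) ∧
    LinearMap.toMatrix bU bV B = Matrix.blockDiagonal' (fun i => (b i).matB) ∧
    typeOfBlocks (Finset.univ.val.map b) = t

/-- A property holds for a generic pair of vectors of a (finite-dimensional) space `V`: it holds for
all pairs at which some nonzero polynomial in the coordinates of the two vectors does not vanish,
that is, on a nonempty Zariski open subset of `V × V` (over an infinite field). -/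
def GenericPair (K : Type*) {V : Type*} [Field K] [AddCommGroup V] [Module K V]
    (P : V → V → Prop) : Prop :=
  ∃ (σ : Type) (e : Module.Basis σ K V) (p : MvPolynomial (σ ⊕ σ) K), p ≠ 0 ∧
    ∀ x a : V, MvPolynomial.eval (Sum.elim (e.repr x) (e.repr a)) p ≠ 0 → P x a

section Representation

attribute [local instance] LieRing.ofAssociativeRing

variable {K L V : Type*} [Field K] [LieRing L] [LieAlgebra K L] [AddCommGroup V] [Module K V]

/-- The operator `R_x : L → V`, `ξ ↦ ρ(ξ) x`. -/
def orbitMap (ρ : L →ₗ⁅K⁆ Module.End K V) (x : V) : L →ₗ[K] V :=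
  (ρ : L →ₗ[K] Module.End K V).flip x

/-- `t` is the Jordan–Kronecker invariant of `ρ`: for a generic pair `(x, a)` the pencil
`R_x + t R_a` has algebraic type `t`. -/
def IsJKInvariant (ρ : L →ₗ⁅K⁆ Module.End K V) (t : AlgebraicType) : Prop :=
  GenericPair K fun x a => HasAlgebraicType (orbitMap ρ x) (orbitMap ρ a) t

/-- The sum of `m` copies of a representation. -/
def sumRep (m : ℕ) (ρ : L →ₗ⁅K⁆ Module.End K V) : L →ₗ⁅K⁆ Module.End K (Fin m → V) where
  toFun ξ := LinearMap.pi fun i => (ρ ξ).comp (LinearMap.proj i)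
  map_add' ξ η := by ext; simp
  map_smul' c ξ := by ext; simp
  map_lie' {ξ η} := by
    apply LinearMap.ext
    intro v
    funext i
    simp [Ring.lie_def]

/-- The standard representation of a Lie algebra of matrices, on column vectors. -/
noncomputable def stdRep {K ι : Type*} [Field K] [Fintype ι] [DecidableEq ι]
    (g : LieSubalgebra K (Matrix ι ι K)) : g →ₗ⁅K⁆ Module.End K (ι → K) :=
  (lieEquivMatrix'.symm : Matrix ι ι K ≃ₗ⁅K⁆ Module.End K (ι → K)).toLieHom.comp g.incl

/-- The sum of `m` standard representations of the Lie algebra `so(n)` of skew-symmetric `n × n`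
matrices. -/
noncomputable def soRep (K : Type*) [Field K] (n m : ℕ) :
    LieAlgebra.Orthogonal.so (Fin n) K →ₗ⁅K⁆ Module.End K (Fin m → Fin n → K) :=
  sumRep m (stdRep (LieAlgebra.Orthogonal.so (Fin n) K))

/-- The sum of `m` standard representations of the symplectic Lie algebra of `2k × 2k` matrices
(acting on the space of dimension `n = 2k`). -/
noncomputable def spRep (K : Type*) [Field K] (k m : ℕ) :
    LieAlgebra.Symplectic.sp (Fin k) K →ₗ⁅K⁆ Module.End K (Fin m → Fin k ⊕ Fin k → K) :=
  sumRep m (stdRep (LieAlgebra.Symplectic.sp (Fin k) K))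

end Representation

end JK

/-! Write `x` as an `m × n` matrix `X` with rows `x i`. Then `R_x ξ` is the matrix `X ξᵀ`. For
so(n), `S = ξᵀ` runs over the skew matrices; for sp(n), `ξ = -J S` with `S` symmetric and `X ξᵀ = X
S J`, where the factor `J` is an automorphism of the target. In both cases the pencil becomes `S ↦
(X + t A) S` on matrices with `Sᵀ = ε S` (`leftPencil`). Replacing `S` by `P' S P'ᵀ` shows that its
normal form depends only on the class of the matrix pencil `X + t A` under multiplication by
invertible matrices on both sides (`HasBlocks.leftPencil_of_equiv`). It remains to normalise a
generic matrix pencil and to compute with the normal form.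

Case `m < n`, `p = n - m`. A generic pencil is a sum of `p` chains of lengths `q` or `q + 1`: a
chain of length `d` allows surjective prolongation of order `q` only if `d ≥ q` and injective
prolongation of order `q + 1` only if `d ≤ q + 1`, and both properties are open and hold for an
explicit pair of shifts (`exists_chain_bases`, `holdsGenerically_hasBlocks_wide`). On a sum of
chains, `X` and `A` delete the first or the last row of each block of `S`. Block Hankel matrices,
constant on antidiagonals, give for each pair of chains one horizontal block of index `d i + d j +
1`. A complement is formed by the matrices vanishing on a hook (first row and last column) in each
independent block; on it the two maps are jointly injective, so it yields vertical blocks of index 2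
(`hasBlocks_leftPencil_chains`). Counting pairs of chains by length gives the multiplicities.

Case `m > n`, or `m = n` for so(n). Generically `(S, T) ↦ A S + X T` is injective, so every basis
form gives a vertical block of index 2 and the rest of the target consists of zero rows.

Case `m = n` for sp(n). Generically `A` is invertible and `X A⁻¹` has distinct eigenvalues, so the
pair becomes (diagonal, identity). Diagonal `S` give the Jordan blocks; symmetric `S` with zero
diagonal give vertical blocks of index 2.

Every genericity claim is the nonvanishing of a polynomial, checked at one example. -/

namespace JK

/-! ### Block decompositions, their direct sums and the model pencils -/

section Blocks

variable {K U V U₁ V₁ U₂ V₂ : Type*} [Field K]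
  [AddCommGroup U] [Module K U] [AddCommGroup V] [Module K V]
  [AddCommGroup U₁] [Module K U₁] [AddCommGroup V₁] [Module K V₁]
  [AddCommGroup U₂] [Module K U₂] [AddCommGroup V₂] [Module K V₂]

/-- In suitable bases the pencil `A + t B` is block diagonal with the multiset `s` of blocks. -/
def HasBlocks (A B : U →ₗ[K] V) (s : Multiset (Block K)) : Prop :=
  ∃ (ι : Type) (_ : Fintype ι) (_ : DecidableEq ι) (b : ι → Block K)
    (bU : Module.Basis (Σ i, Fin (b i).cols) K U) (bV : Module.Basis (Σ i, Fin (b i).rows) K V),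
    (∀ i c, A (bU ⟨i, c⟩) = ∑ r, (b i).matA r c • bV ⟨i, r⟩) ∧
    (∀ i c, B (bU ⟨i, c⟩) = ∑ r, (b i).matB r c • bV ⟨i, r⟩) ∧
    Finset.univ.val.map b = s

theorem toMatrix_eq_blockDiagonal' {ι : Type} [Fintype ι] [DecidableEq ι] {m n : ι → ℕ}
    (bU : Module.Basis (Σ i, Fin (n i)) K U) (bV : Module.Basis (Σ i, Fin (m i)) K V)
    (A : U →ₗ[K] V) (M : ∀ i, Matrix (Fin (m i)) (Fin (n i)) K)
    (h : ∀ i c, A (bU ⟨i, c⟩) = ∑ r, M i r c • bV ⟨i, r⟩) :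
    LinearMap.toMatrix bU bV A = Matrix.blockDiagonal' M := by
  ext ⟨k, r⟩ ⟨i, c⟩
  rw [LinearMap.toMatrix_apply, h, map_sum, Finsupp.finsetSum_apply]
  simp only [map_smul, Module.Basis.repr_self, Finsupp.smul_single, smul_eq_mul, mul_one]
  by_cases hki : k = i
  · subst hki
    rw [Matrix.blockDiagonal'_apply_eq, Finset.sum_eq_single r]
    · simp
    · intro x _ hx
      rw [Finsupp.single_eq_of_ne]
      simpa using Ne.symm hx
    · simp
  · rw [Matrix.blockDiagonal'_apply_ne _ _ _ hki]
    refine Finset.sum_eq_zero fun x _ => ?_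
    rw [Finsupp.single_eq_of_ne]
    simp [hki]

theorem HasBlocks.hasAlgebraicType {A B : U →ₗ[K] V} {s : Multiset (Block K)}
    (h : HasBlocks A B s) : HasAlgebraicType A B (typeOfBlocks s) := by
  obtain ⟨ι, _, _, b, bU, bV, hA, hB, rfl⟩ := h
  exact ⟨ι, _, _, b, bU, bV, toMatrix_eq_blockDiagonal' bU bV A _ hA,
    toMatrix_eq_blockDiagonal' bU bV B _ hB, rfl⟩

theorem HasBlocks.of_equiv {A B : U →ₗ[K] V} {A₁ B₁ : U₁ →ₗ[K] V₁} {s : Multiset (Block K)}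
    (h : HasBlocks A₁ B₁ s) (e : U₁ ≃ₗ[K] U) (f : V₁ ≃ₗ[K] V)
    (hA : ∀ u, A (e u) = f (A₁ u)) (hB : ∀ u, B (e u) = f (B₁ u)) : HasBlocks A B s := by
  obtain ⟨ι, _, _, b, bU, bV, hA', hB', rfl⟩ := h
  refine ⟨ι, _, ‹_›, b, bU.map e, bV.map f, ?_, ?_, rfl⟩
  · intro i c
    simp [hA, hA']
  · intro i c
    simp [hB, hB']

theorem prod_reindex_inl {ι₁ ι₂ : Type} {p : ι₁ ⊕ ι₂ → ℕ}
    (b₁ : Module.Basis (Σ i, Fin (p (Sum.inl i))) K U₁)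
    (b₂ : Module.Basis (Σ i, Fin (p (Sum.inr i))) K U₂) (i : ι₁) (c : Fin (p (Sum.inl i))) :
    ((b₁.prod b₂).reindex (Equiv.sumSigmaDistrib fun i => Fin (p i)).symm) ⟨Sum.inl i, c⟩ =
      (b₁ ⟨i, c⟩, 0) := by
  rw [Module.Basis.reindex_apply, Equiv.symm_symm]
  simp [Equiv.sumSigmaDistrib]

theorem prod_reindex_inr {ι₁ ι₂ : Type} {p : ι₁ ⊕ ι₂ → ℕ}
    (b₁ : Module.Basis (Σ i, Fin (p (Sum.inl i))) K U₁)
    (b₂ : Module.Basis (Σ i, Fin (p (Sum.inr i))) K U₂) (i : ι₂) (c : Fin (p (Sum.inr i))) :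
    ((b₁.prod b₂).reindex (Equiv.sumSigmaDistrib fun i => Fin (p i)).symm) ⟨Sum.inr i, c⟩ =
      (0, b₂ ⟨i, c⟩) := by
  rw [Module.Basis.reindex_apply, Equiv.symm_symm]
  simp [Equiv.sumSigmaDistrib]

theorem HasBlocks.prod {A₁ B₁ : U₁ →ₗ[K] V₁} {A₂ B₂ : U₂ →ₗ[K] V₂} {s₁ s₂ : Multiset (Block K)}
    (h₁ : HasBlocks A₁ B₁ s₁) (h₂ : HasBlocks A₂ B₂ s₂) :
    HasBlocks (A₁.prodMap A₂) (B₁.prodMap B₂) (s₁ + s₂) := by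
  obtain ⟨ι₁, _, _, b₁, bU₁, bV₁, hA₁, hB₁, rfl⟩ := h₁
  obtain ⟨ι₂, _, _, b₂, bU₂, bV₂, hA₂, hB₂, rfl⟩ := h₂
  let BU : Module.Basis (Σ i, Fin (Sum.elim b₁ b₂ i).cols) K (U₁ × U₂) :=
    (bU₁.prod bU₂).reindex (Equiv.sumSigmaDistrib fun i => Fin (Sum.elim b₁ b₂ i).cols).symm
  let BV : Module.Basis (Σ i, Fin (Sum.elim b₁ b₂ i).rows) K (V₁ × V₂) :=
    (bV₁.prod bV₂).reindex (Equiv.sumSigmaDistrib fun i => Fin (Sum.elim b₁ b₂ i).rows).symm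
  have hU₁ : ∀ i (c : Fin (b₁ i).cols), BU ⟨Sum.inl i, c⟩ = (bU₁ ⟨i, c⟩, 0) :=
    prod_reindex_inl (p := fun i => (Sum.elim b₁ b₂ i).cols) bU₁ bU₂
  have hU₂ : ∀ i (c : Fin (b₂ i).cols), BU ⟨Sum.inr i, c⟩ = (0, bU₂ ⟨i, c⟩) :=
    prod_reindex_inr (p := fun i => (Sum.elim b₁ b₂ i).cols) bU₁ bU₂
  have hV₁ : ∀ i (c : Fin (b₁ i).rows), BV ⟨Sum.inl i, c⟩ = (bV₁ ⟨i, c⟩, 0) :=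
    prod_reindex_inl (p := fun i => (Sum.elim b₁ b₂ i).rows) bV₁ bV₂
  have hV₂ : ∀ i (c : Fin (b₂ i).rows), BV ⟨Sum.inr i, c⟩ = (0, bV₂ ⟨i, c⟩) :=
    prod_reindex_inr (p := fun i => (Sum.elim b₁ b₂ i).rows) bV₁ bV₂
  have inl_case : ∀ (T₁ : U₁ →ₗ[K] V₁) (T₂ : U₂ →ₗ[K] V₂) i (c : Fin (b₁ i).cols)
      (m : Fin (b₁ i).rows → K), T₁ (bU₁ ⟨i, c⟩) = ∑ r, m r • bV₁ ⟨i, r⟩ →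
      T₁.prodMap T₂ (BU ⟨Sum.inl i, c⟩) =
        ∑ r : Fin (b₁ i).rows, m r • BV ⟨Sum.inl i, r⟩ := by
    intro T₁ T₂ i c m h
    rw [hU₁]
    simp only [hV₁, LinearMap.prodMap_apply, h, map_zero]
    simp [Prod.ext_iff, Prod.fst_sum, Prod.snd_sum]
  have inr_case : ∀ (T₁ : U₁ →ₗ[K] V₁) (T₂ : U₂ →ₗ[K] V₂) i (c : Fin (b₂ i).cols)
      (m : Fin (b₂ i).rows → K), T₂ (bU₂ ⟨i, c⟩) = ∑ r, m r • bV₂ ⟨i, r⟩ →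
      T₁.prodMap T₂ (BU ⟨Sum.inr i, c⟩) =
        ∑ r : Fin (b₂ i).rows, m r • BV ⟨Sum.inr i, r⟩ := by
    intro T₁ T₂ i c m h
    rw [hU₂]
    simp only [hV₂, LinearMap.prodMap_apply, h, map_zero]
    simp [Prod.ext_iff, Prod.fst_sum, Prod.snd_sum]
  refine ⟨ι₁ ⊕ ι₂, inferInstance, inferInstance, Sum.elim b₁ b₂, BU, BV, ?_, ?_, ?_⟩
  · rintro (i | i) c
    · exact inl_case _ _ i c _ (hA₁ i c)
    · exact inr_case _ _ i c _ (hA₂ i c)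
  · rintro (i | i) c
    · exact inl_case _ _ i c _ (hB₁ i c)
    · exact inr_case _ _ i c _ (hB₂ i c)
  · rw [← Finset.univ_disjSum_univ, Finset.val_disjSum, Multiset.disjSum, Multiset.map_add,
      Multiset.map_map, Multiset.map_map]
    rfl

/-- Restriction of families indexed by `Fin (k i + 1)` to the last `k i` places. -/
def shiftSucc {ι : Type} (k : ι → ℕ) : (∀ i, Fin (k i + 1) → K) →ₗ[K] (∀ i, Fin (k i) → K) where
  toFun f i c := f i c.succ
  map_add' _ _ := rfl
  map_smul' _ _ := rfl

/-- Restriction of families indexed by `Fin (k i + 1)` to the first `k i` places. -/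
def shiftCast {ι : Type} (k : ι → ℕ) : (∀ i, Fin (k i + 1) → K) →ₗ[K] (∀ i, Fin (k i) → K) where
  toFun f i c := f i c.castSucc
  map_add' _ _ := rfl
  map_smul' _ _ := rfl

/-- In the standard bases, dropping the first or the last coordinate of `K^(k+1)` is exactly the
horizontal block with `k` rows. -/
theorem hasBlocks_shift {ι : Type} [Fintype ι] (k : ι → ℕ) :
    HasBlocks (shiftSucc (K := K) k) (shiftCast k)
      (Finset.univ.val.map fun i => Block.horizontal (k i)) := by
  classical
  let eU : Module.Basis (Σ i, Fin (k i + 1)) K (∀ i, Fin (k i + 1) → K) :=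
    Pi.basis fun i => Pi.basisFun K (Fin (k i + 1))
  let eV : Module.Basis (Σ i, Fin (k i)) K (∀ i, Fin (k i) → K) :=
    Pi.basis fun i => Pi.basisFun K (Fin (k i))
  have hA : ∀ i (c : Fin (k i + 1)), shiftSucc k (eU ⟨i, c⟩) =
      ∑ r : Fin (k i), (if (c : ℕ) = r + 1 then (1 : K) else 0) • eV ⟨i, r⟩ := by
    intro i c
    ext j x
    rw [Finset.sum_apply, Finset.sum_apply]
    simp only [Pi.smul_apply, Pi.basis_apply, Pi.basisFun_apply, shiftSucc, LinearMap.coe_mk,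
      AddHom.coe_mk, eU, eV]
    by_cases hij : j = i
    · subst hij
      simp [Pi.single_apply, eq_comm, ← Fin.ext_iff]
      try simp [Fin.ext_iff, eq_comm]
    · simp [hij]
  have hB : ∀ i (c : Fin (k i + 1)), shiftCast k (eU ⟨i, c⟩) =
      ∑ r : Fin (k i), (if (c : ℕ) = r then (1 : K) else 0) • eV ⟨i, r⟩ := by
    intro i c
    ext j x
    rw [Finset.sum_apply, Finset.sum_apply]
    simp only [Pi.smul_apply, Pi.basis_apply, Pi.basisFun_apply, shiftCast, LinearMap.coe_mk,
      AddHom.coe_mk, eU, eV]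
    by_cases hij : j = i
    · subst hij
      simp [Pi.single_apply, eq_comm, ← Fin.ext_iff]
      try simp [Fin.ext_iff, eq_comm]
    · simp [hij]
  exact ⟨ι, _, inferInstance, fun i => Block.horizontal (k i), eU, eV, hA, hB, rfl⟩

/-- The model of two injective maps with independent images: a basis vector `u` with its images `(u,
0)` and `(0, u)` spans one `2 × 1` block. -/
theorem hasBlocks_inr_inl [FiniteDimensional K U] :
    HasBlocks (LinearMap.inr K U U) (LinearMap.inl K U U)
      (Multiset.replicate (Module.finrank K U) (Block.vertical 1)) := by
  let b := Module.finBasis K U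
  let e₁ : Fin (Module.finrank K U) ≃ (Σ _ : Fin (Module.finrank K U), Fin 1) :=
    { toFun := fun i => ⟨i, 0⟩
      invFun := fun x => x.1
      left_inv := fun _ => rfl
      right_inv := fun ⟨i, c⟩ => by rw [Subsingleton.elim c 0] }
  let e₂ : Fin (Module.finrank K U) ⊕ Fin (Module.finrank K U) ≃
      (Σ _ : Fin (Module.finrank K U), Fin 2) :=
    { toFun := Sum.elim (fun i => ⟨i, 0⟩) (fun i => ⟨i, 1⟩)
      invFun := fun x => if x.2 = 0 then Sum.inl x.1 else Sum.inr x.1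
      left_inv := by rintro (i | i) <;> simp
      right_inv := by
        rintro ⟨i, c⟩
        fin_cases c <;> simp }
  have hA : ∀ i (c : Fin 1), LinearMap.inr K U U (b.reindex e₁ ⟨i, c⟩) =
      ∑ r : Fin 2, (if (r : ℕ) = c + 1 then (1 : K) else 0) • (b.prod b).reindex e₂ ⟨i, r⟩ := by
    intro i c
    rw [Subsingleton.elim c 0]
    simp [e₁, e₂]
  have hB : ∀ i (c : Fin 1), LinearMap.inl K U U (b.reindex e₁ ⟨i, c⟩) =
      ∑ r : Fin 2, (if (r : ℕ) = c then (1 : K) else 0) • (b.prod b).reindex e₂ ⟨i, r⟩ := by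
    intro i c
    rw [Subsingleton.elim c 0]
    simp [e₁, e₂]
  exact ⟨Fin (Module.finrank K U), inferInstance, inferInstance, fun _ => Block.vertical 1,
    b.reindex e₁, (b.prod b).reindex e₂, hA, hB, by simp [Multiset.map_const']⟩

theorem hasBlocks_zero [FiniteDimensional K V] [Subsingleton U] (A B : U →ₗ[K] V) :
    HasBlocks A B (Multiset.replicate (Module.finrank K V) (Block.vertical 0)) := by
  let b := Module.finBasis K V
  let e₁ : Fin (Module.finrank K V) ≃ (Σ _ : Fin (Module.finrank K V), Fin 1) :=
    { toFun := fun i => ⟨i, 0⟩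
      invFun := fun x => x.1
      left_inv := fun _ => rfl
      right_inv := fun ⟨i, c⟩ => by rw [Subsingleton.elim c 0] }
  have : IsEmpty (Σ i : Fin (Module.finrank K V), Fin (Block.vertical (K := K) 0).cols) :=
    ⟨fun x => x.2.elim0⟩
  refine ⟨Fin (Module.finrank K V), inferInstance, inferInstance, fun _ => Block.vertical 0,
    Module.Basis.empty U, b.reindex e₁, ?_, ?_, ?_⟩
  · intro i c
    exact c.elim0
  · intro i c
    exact c.elim0
  · simp [Multiset.map_const']

theorem hasBlocks_diagonal {η : Type} [Fintype η] (μ : η → K) :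
    HasBlocks (LinearMap.pi fun i => μ i • LinearMap.proj i : (η → K) →ₗ[K] (η → K))
      LinearMap.id (Finset.univ.val.map fun i => Block.jordan (μ i : OnePoint K) 0) := by
  classical
  let e₁ : η ≃ (Σ _ : η, Fin 1) :=
    { toFun := fun i => ⟨i, 0⟩
      invFun := fun x => x.1
      left_inv := fun _ => rfl
      right_inv := fun ⟨i, c⟩ => by rw [Subsingleton.elim c 0] }
  have hA : ∀ i (c : Fin 1), (LinearMap.pi fun i => μ i • LinearMap.proj i : (η → K) →ₗ[K] (η → K))
      ((Pi.basisFun K η).reindex e₁ ⟨i, c⟩) =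
      ∑ r : Fin 1, (if (c : ℕ) = r then μ i else if (c : ℕ) = r + 1 then 1 else 0) •
        (Pi.basisFun K η).reindex e₁ ⟨i, r⟩ := by
    intro i c
    rw [Subsingleton.elim c 0]
    ext j
    by_cases hij : j = i
    · subst hij; simp [e₁]
    · simp [e₁, hij]
  have hB : ∀ i (c : Fin 1), LinearMap.id (R := K) ((Pi.basisFun K η).reindex e₁ ⟨i, c⟩) =
      ∑ r : Fin 1, (1 : Matrix (Fin 1) (Fin 1) K) r c • (Pi.basisFun K η).reindex e₁ ⟨i, r⟩ := by
    intro i c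
    rw [Subsingleton.elim c 0]
    simp
  exact ⟨η, _, inferInstance, fun i => Block.jordan (μ i : OnePoint K) 0,
    (Pi.basisFun K η).reindex e₁, (Pi.basisFun K η).reindex e₁, hA, hB, rfl⟩

theorem filterMap_eq_zero {α β : Type*} {f : α → Option β} {s : Multiset α}
    (h : ∀ a ∈ s, f a = none) : s.filterMap f = 0 := by
  refine Multiset.eq_zero_of_forall_notMem fun b hb => ?_
  obtain ⟨a, ha, hab⟩ := (Multiset.mem_filterMap _ _).1 hb
  simp [h a ha] at hab

theorem filterMap_replicate_some {α β : Type*} {f : α → Option β} {a : α} {b : β}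
    (h : f a = some b) (n : ℕ) :
    (Multiset.replicate n a).filterMap f = Multiset.replicate n b := by
  induction n with
  | zero => rfl
  | succ n ih => rw [Multiset.replicate_succ, Multiset.replicate_succ,
      Multiset.filterMap_cons_some _ _ _ h, ih]

theorem typeOfBlocks_horizontal_vertical {ι : Type} [Fintype ι] (k : ι → ℕ) (a b : ℕ) :
    typeOfBlocks (Finset.univ.val.map (fun i => (Block.horizontal (k i) : Block K)) +
      (Multiset.replicate a (Block.vertical 1) + Multiset.replicate b (Block.vertical 0))) =
    { jordan := 0
      horizontal := Finset.univ.val.map fun i => k i + 1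
      vertical := Multiset.replicate a 2 + Multiset.replicate b 1 } := by
  simp only [typeOfBlocks, AlgebraicType.mk.injEq]
  refine ⟨?_, ?_, ?_⟩
  · rw [filterMap_eq_zero]
    · rfl
    · intro x hx
      simp only [Multiset.mem_add, Multiset.mem_map, Multiset.mem_replicate] at hx
      obtain ⟨i, -, rfl⟩ | ⟨-, rfl⟩ | ⟨-, rfl⟩ := hx <;> rfl
  · rw [Multiset.filterMap_add, filterMap_eq_zero (s := _ + _), add_zero, Multiset.filterMap_map]
    · exact congrFun (Multiset.filterMap_eq_map _) _
    · intro x hx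
      simp only [Multiset.mem_add, Multiset.mem_replicate] at hx
      obtain ⟨-, rfl⟩ | ⟨-, rfl⟩ := hx <;> rfl
  · rw [Multiset.filterMap_add, Multiset.filterMap_add,
      filterMap_replicate_some (f := Block.verticalIndex?) (a := Block.vertical 1) (b := 2) rfl,
      filterMap_replicate_some (f := Block.verticalIndex?) (a := Block.vertical 0) (b := 1) rfl,
      filterMap_eq_zero, zero_add]
    intro x hx
    obtain ⟨i, -, rfl⟩ := Multiset.mem_map.1 hx
    rfl

/-- Since `μ` is injective, no eigenvalue is lost to `dedup` and each one collects a single block,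
of size 1. -/
theorem typeOfBlocks_jordan_vertical {η : Type} [Fintype η] (μ : η → K)
    (hμ : Function.Injective μ) (a : ℕ) :
    typeOfBlocks (Finset.univ.val.map (fun i => (Block.jordan (μ i : OnePoint K) 0 : Block K)) +
      Multiset.replicate a (Block.vertical 1)) =
    { jordan := Multiset.replicate (Fintype.card η) {1}
      horizontal := 0
      vertical := Multiset.replicate a 2 } := by
  classical
  have hinj : Function.Injective fun i => (μ i : OnePoint K) :=
    OnePoint.coe_injective.comp hμ
  simp only [typeOfBlocks, AlgebraicType.mk.injEq]
  refine ⟨?_, ?_, ?_⟩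
  · have h₁ : (Finset.univ.val.map (fun i => (Block.jordan (μ i : OnePoint K) 0 : Block K)) +
        Multiset.replicate a (Block.vertical 1)).filterMap Block.eigenvalue? =
        Finset.univ.val.map fun i => (μ i : OnePoint K) := by
      rw [Multiset.filterMap_add, filterMap_eq_zero (s := Multiset.replicate _ _), add_zero,
        Multiset.filterMap_map]
      · exact congrFun (Multiset.filterMap_eq_map _) _
      · intro x hx
        rw [Multiset.eq_of_mem_replicate hx]
        rfl
    rw [h₁, Multiset.dedup_eq_self.2 ((Multiset.nodup_map_iff_of_injective hinj).2 Finset.univ.nodup),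
      Multiset.map_map, ← Finset.card_univ, Finset.card, ← Multiset.map_const']
    refine Multiset.map_congr rfl fun i _ => ?_
    rw [Function.comp_apply, Multiset.filterMap_add,
      filterMap_eq_zero (s := Multiset.replicate _ _), add_zero, Multiset.filterMap_map]
    · have h₂ : (Finset.univ : Finset η) = insert i (Finset.univ.erase i) := by simp
      rw [h₂, Finset.insert_val_of_notMem (by simp), Multiset.filterMap_cons_some (b := 1),
        filterMap_eq_zero]
      · rfl
      · intro j hj
        have hne : j ≠ i := Finset.ne_of_mem_erase hj
        simpa [Block.jordanSize?] using fun h => hne (hμ h)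
      · simp [Block.jordanSize?]
    · intro x hx
      rw [Multiset.eq_of_mem_replicate hx]
      rfl
  · refine filterMap_eq_zero fun x hx => ?_
    simp only [Multiset.mem_add, Multiset.mem_map, Multiset.mem_replicate] at hx
    obtain ⟨i, -, rfl⟩ | ⟨-, rfl⟩ := hx <;> rfl
  · rw [Multiset.filterMap_add,
      filterMap_replicate_some (f := Block.verticalIndex?) (a := Block.vertical 1) (b := 2) rfl,
      filterMap_eq_zero, zero_add]
    intro x hx
    obtain ⟨i, -, rfl⟩ := Multiset.mem_map.1 hx
    rfl

end Blocks

/-! ### Generic properties of pairs of vectors -/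

section Generic

open Module

variable {K V E F : Type*} [Field K] [AddCommGroup V] [Module K V] [FiniteDimensional K V]
  [AddCommGroup E] [Module K E] [FiniteDimensional K E] [AddCommGroup F] [Module K F]

/-- Evaluation, at a pair of vectors, of a polynomial in the coordinates of two vectors. -/
noncomputable def evalPair (x a : V) :
    MvPolynomial (Fin (finrank K V) ⊕ Fin (finrank K V)) K →+* K :=
  MvPolynomial.eval (Sum.elim ((finBasis K V).repr x) ((finBasis K V).repr a))

variable (K) in
/-- A property of pairs of vectors that holds on a nonempty principal Zariski open subset. -/
def HoldsGenerically (P : V → V → Prop) : Prop :=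
  ∃ p : MvPolynomial (Fin (finrank K V) ⊕ Fin (finrank K V)) K, p ≠ 0 ∧
    ∀ x a : V, evalPair x a p ≠ 0 → P x a

theorem HoldsGenerically.genericPair {P Q : V → V → Prop} (h : HoldsGenerically K P)
    (hPQ : ∀ x a, P x a → Q x a) : GenericPair K Q := by
  obtain ⟨p, hp, h⟩ := h
  exact ⟨_, finBasis K V, p, hp, fun x a hx => hPQ x a (h x a hx)⟩

theorem HoldsGenerically.and {P Q : V → V → Prop} (hP : HoldsGenerically K P)
    (hQ : HoldsGenerically K Q) : HoldsGenerically K fun x a => P x a ∧ Q x a := by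
  obtain ⟨p, hp, hP⟩ := hP
  obtain ⟨q, hq, hQ⟩ := hQ
  refine ⟨p * q, mul_ne_zero hp hq, fun x a h => ?_⟩
  rw [map_mul] at h
  exact ⟨hP x a (left_ne_zero_of_mul h), hQ x a (right_ne_zero_of_mul h)⟩

theorem HoldsGenerically.of_ne_zero {P : V → V → Prop}
    (p : MvPolynomial (Fin (finrank K V) ⊕ Fin (finrank K V)) K) (x₀ a₀ : V)
    (h₀ : evalPair x₀ a₀ p ≠ 0) (h : ∀ x a : V, evalPair x a p ≠ 0 → P x a) :
    HoldsGenerically K P :=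
  ⟨p, fun hp => h₀ (by rw [hp, map_zero]), h⟩

theorem exists_evalPair_eq (l : V × V →ₗ[K] K) :
    ∃ p : MvPolynomial (Fin (finrank K V) ⊕ Fin (finrank K V)) K,
      ∀ x a : V, evalPair x a p = l (x, a) := by
  let b := finBasis K V
  refine ⟨∑ i, MvPolynomial.C (l (b i, 0)) * MvPolynomial.X (Sum.inl i) +
    ∑ i, MvPolynomial.C (l (0, b i)) * MvPolynomial.X (Sum.inr i), fun x a => ?_⟩
  have hx : l (x, 0) = ∑ i, l (b i, 0) * b.repr x i := by
    conv_lhs => rw [← b.sum_repr x]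
    have := map_sum (l ∘ₗ LinearMap.inl K V V) (fun i => b.repr x i • b i) Finset.univ
    simpa [mul_comm] using this
  have ha : l (0, a) = ∑ i, l (0, b i) * b.repr a i := by
    conv_lhs => rw [← b.sum_repr a]
    have := map_sum (l ∘ₗ LinearMap.inr K V V) (fun i => b.repr a i • b i) Finset.univ
    simpa [mul_comm] using this
  have : (x, a) = (x, 0) + (0, a) := by simp
  rw [this, l.map_add, hx, ha]
  simp [evalPair, b]

/-- If a linear family of endomorphisms contains an invertible one, its generic member is
invertible. -/
theorem holdsGenerically_bijective (T : V × V →ₗ[K] E →ₗ[K] E) (x₀ a₀ : V)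
    (h₀ : T (x₀, a₀) = LinearMap.id) :
    HoldsGenerically K fun x a => Function.Bijective (T (x, a)) := by
  let b := finBasis K E
  have key : ∀ i j, ∃ p : MvPolynomial (Fin (finrank K V) ⊕ Fin (finrank K V)) K,
      ∀ x a : V, evalPair x a p = LinearMap.toMatrix b b (T (x, a)) i j := by
    intro i j
    obtain ⟨p, hp⟩ := exists_evalPair_eq (b.coord i ∘ₗ LinearMap.applyₗ (b j) ∘ₗ T)
    exact ⟨p, fun x a => by rw [hp]; simp [LinearMap.toMatrix_apply]⟩
  choose P hP using key
  have hdet : ∀ x a : V, evalPair x a (Matrix.of P).det = LinearMap.det (T (x, a)) := by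
    intro x a
    rw [RingHom.map_det, ← LinearMap.det_toMatrix b]
    congr 1
    ext i j
    simp [hP]
  refine HoldsGenerically.of_ne_zero (Matrix.of P).det x₀ a₀ ?_ fun x a h => ?_
  · rw [hdet, h₀, LinearMap.det_id]
    exact one_ne_zero
  · rw [hdet] at h
    exact (LinearMap.equivOfDetNeZero _ h).bijective

theorem HoldsGenerically.mono {P Q : V → V → Prop} (h : HoldsGenerically K P)
    (hPQ : ∀ x a, P x a → Q x a) : HoldsGenerically K Q := by
  obtain ⟨p, hp, h⟩ := h
  exact ⟨p, hp, fun x a hx => hPQ x a (h x a hx)⟩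

/-- If a linear family of linear maps contains an injective map, its generic member is injective. -/
theorem holdsGenerically_injective (T : V × V →ₗ[K] E →ₗ[K] F) (x₀ a₀ : V)
    (h₀ : Function.Injective (T (x₀, a₀))) :
    HoldsGenerically K fun x a => Function.Injective (T (x, a)) := by
  -- Composition with one fixed left inverse `S` gives a linear family of endomorphisms that is the
  -- identity at `(x₀, a₀)`; wherever its determinant is nonzero, `T (x, a)` is injective.
  obtain ⟨S, hS⟩ := (T (x₀, a₀)).exists_leftInverse_of_injective (LinearMap.ker_eq_bot.2 h₀)
  exact (holdsGenerically_bijective (LinearMap.compRight K S ∘ₗ T) x₀ a₀ hS).mono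
    fun x a h => Function.Injective.of_comp (f := S) h.injective

/-- If a linear family of linear maps contains a surjective map, its generic member is
surjective. -/
theorem holdsGenerically_surjective [FiniteDimensional K F] (T : V × V →ₗ[K] E →ₗ[K] F)
    (x₀ a₀ : V) (h₀ : Function.Surjective (T (x₀, a₀))) :
    HoldsGenerically K fun x a => Function.Surjective (T (x, a)) := by
  obtain ⟨S, hS⟩ := (T (x₀, a₀)).exists_rightInverse_of_surjective (LinearMap.range_eq_top.2 h₀)
  exact (holdsGenerically_bijective (LinearMap.lcomp K F S ∘ₗ T) x₀ a₀ hS).mono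
    fun x a h => Function.Surjective.of_comp (g := S) h.surjective

end Generic

/-! ### Kronecker chains from surjective and injective prolongations -/

section Chains

open Module

universe u

variable {K : Type*} [Field K]

/-- Joint injectivity makes `W` the sum of two copies of `M`, embedded by `A` and `X`, and a
complement `C`. A basis vector of `M` gives a chain of length 1, a basis vector of `C` a chain of
length 0. -/
theorem exists_chain_bases_of_injective {M W : Type u} [AddCommGroup M] [Module K M]
    [FiniteDimensional K M] [AddCommGroup W] [Module K W] [FiniteDimensional K W]
    (X A : M →ₗ[K] W) (h : ∀ u v, X u + A v = 0 → u = 0 ∧ v = 0) :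
    ∃ (ι : Type) (_ : Fintype ι) (d : ι → ℕ) (e : Basis (Σ i, Fin (d i)) K M)
      (f : Basis (Σ i, Fin (d i + 1)) K W), (∀ i, d i = 0 ∨ d i = 1) ∧
      (∀ i j, A (e ⟨i, j⟩) = f ⟨i, j.castSucc⟩) ∧ ∀ i j, X (e ⟨i, j⟩) = f ⟨i, j.succ⟩ := by
  let T : M × M →ₗ[K] W := A.coprod X
  have hT : Function.Injective T := by
    rw [injective_iff_map_eq_zero]
    rintro ⟨v, u⟩ huv
    obtain ⟨rfl, rfl⟩ := h u v (by simpa [T, add_comm] using huv)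
    rfl
  obtain ⟨C, hC⟩ := Submodule.exists_isCompl (LinearMap.range T)
  let g : ((M × M) × C) ≃ₗ[K] W :=
    (LinearEquiv.prodCongr (LinearEquiv.ofInjective T hT) (LinearEquiv.refl K C)).trans
      (Submodule.prodEquivOfIsCompl _ C hC)
  let b := finBasis K M
  let c := finBasis K C
  let d : Fin (finrank K M) ⊕ Fin (finrank K C) → ℕ := Sum.elim (fun _ => 1) (fun _ => 0)
  let eM : Fin (finrank K M) ≃ (Σ i, Fin (d i)) := Equiv.ofBijective
    (fun i => ⟨Sum.inl i, (0 : Fin 1)⟩) (by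
      constructor
      · intro i j hij
        simpa using congrArg Sigma.fst hij
      · rintro ⟨i | i, j⟩
        · exact ⟨i, by rw [Subsingleton.elim (α := Fin 1) j 0]⟩
        · exact Fin.elim0 j)
  let eW : (Fin (finrank K M) ⊕ Fin (finrank K M)) ⊕ Fin (finrank K C) ≃ (Σ i, Fin (d i + 1)) :=
    Equiv.ofBijective
      (Sum.elim (Sum.elim (fun i => ⟨Sum.inl i, (0 : Fin 2)⟩) (fun i => ⟨Sum.inl i, (1 : Fin 2)⟩))
        (fun i => ⟨Sum.inr i, (0 : Fin 1)⟩)) (by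
      constructor
      · rintro ((i | i) | i) ((j | j) | j) hij <;>
          simp_all [Sigma.ext_iff, d]
      · rintro ⟨i | i, j⟩
        · obtain rfl | rfl := Fin.exists_fin_two.1 ⟨(j : Fin 2), rfl⟩
          · exact ⟨Sum.inl (Sum.inl i), rfl⟩
          · exact ⟨Sum.inl (Sum.inr i), rfl⟩
        · exact ⟨Sum.inr i, by rw [Subsingleton.elim (α := Fin 1) j 0]; rfl⟩)
  refine ⟨_, inferInstance, d, b.reindex eM, (((b.prod b).prod c).map g).reindex eW, ?_, ?_, ?_⟩
  · rintro (i | i)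
    · exact Or.inr rfl
    · exact Or.inl rfl
  · rintro (i | i) j
    · obtain rfl : j = (0 : Fin 1) := Subsingleton.elim (α := Fin 1) _ _
      have h₁ : eM.symm ⟨Sum.inl i, (0 : Fin 1)⟩ = i := eM.symm_apply_eq.2 rfl
      have h₂ : eW.symm ⟨Sum.inl i, (0 : Fin 2)⟩ = Sum.inl (Sum.inl i) := eW.symm_apply_eq.2 rfl
      rw [Basis.reindex_apply, Basis.reindex_apply, h₁]
      refine Eq.trans ?_ (congrArg _ h₂.symm)
      simp [g, T]
    · exact Fin.elim0 j
  · rintro (i | i) j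
    · obtain rfl : j = (0 : Fin 1) := Subsingleton.elim (α := Fin 1) _ _
      have h₁ : eM.symm ⟨Sum.inl i, (0 : Fin 1)⟩ = i := eM.symm_apply_eq.2 rfl
      have h₂ : eW.symm ⟨Sum.inl i, (1 : Fin 2)⟩ = Sum.inl (Sum.inr i) := eW.symm_apply_eq.2 rfl
      rw [Basis.reindex_apply, Basis.reindex_apply, h₁]
      refine Eq.trans ?_ (congrArg _ h₂.symm)
      simp [g, T]
    · exact Fin.elim0 j

/-- A pencil `X + t A` whose prolongations `(uᵢ) ↦ (X uᵢ + A uᵢ₊₁)` are surjective up to length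
`q` and injective afterwards is a sum of vertical Kronecker blocks of widths `q` and `q + 1`. -/
theorem exists_chain_bases (q : ℕ) : ∀ {M W : Type u} [AddCommGroup M] [Module K M]
    [FiniteDimensional K M] [AddCommGroup W] [Module K W] [FiniteDimensional K W]
    (X A : M →ₗ[K] W)
    (_ : ∀ v : ℕ → W, ∃ u : ℕ → M, ∀ i < q, X (u i) + A (u (i + 1)) = v i)
    (_ : ∀ u : ℕ → M, (∀ i ≤ q, X (u i) + A (u (i + 1)) = 0) → ∀ i ≤ q + 1, u i = 0),
    ∃ (ι : Type) (_ : Fintype ι) (d : ι → ℕ) (e : Basis (Σ i, Fin (d i)) K M)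
      (f : Basis (Σ i, Fin (d i + 1)) K W), (∀ i, d i = q ∨ d i = q + 1) ∧
      (∀ i j, A (e ⟨i, j⟩) = f ⟨i, j.castSucc⟩) ∧ ∀ i j, X (e ⟨i, j⟩) = f ⟨i, j.succ⟩ := by
  induction q with
  | zero =>
    intro M W _ _ _ _ _ _ X A _ hi
    refine exists_chain_bases_of_injective X A fun u v huv => ?_
    have := hi (fun i => if i = 0 then u else v) (by
      intro i hi
      obtain rfl : i = 0 := by omega
      simpa using huv)
    exact ⟨by simpa using this 0 (by omega), by simpa using this 1 (by omega)⟩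
  | succ q ih =>
    intro M W _ _ _ _ _ _ X A hs hi
    have hA : Function.Injective A := by
      rw [injective_iff_map_eq_zero]
      intro v hv
      have := hi (fun i => if i = q + 2 then v else 0) (by
        intro i hi
        by_cases h : i = q + 1
        · subst h; simpa using hv
        · have h₁ : i ≠ q + 2 := by omega
          simp [h, h₁]) (q + 2) le_rfl
      simpa using this
    have hXA : ∀ w : W, ∃ u v, X u + A v = w := fun w => by
      obtain ⟨u, hu⟩ := hs fun _ => w
      exact ⟨_, _, hu 0 (by omega)⟩
    -- The derived pencil `M' → M` consists of `A⁻¹ X` and the inclusion. Passing to it shortens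
    -- every chain by one, so it satisfies the hypotheses for `q`.
    let M' : Submodule K M := (LinearMap.range A).comap X
    let X' : M' →ₗ[K] M := (LinearEquiv.ofInjective A hA).symm.toLinearMap ∘ₗ
      (X ∘ₗ M'.subtype).codRestrict (LinearMap.range A) fun u => u.2
    have hX' : ∀ u : M', A (X' u) = X u := fun u => by
      have := (LinearEquiv.ofInjective A hA).apply_symm_apply
        ((X ∘ₗ M'.subtype).codRestrict (LinearMap.range A) (fun u => u.2) u)
      exact congrArg Subtype.val this
    obtain ⟨ι, _, d, e', f', hd, hAe, hXe⟩ := ih X' M'.subtype (by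
      intro v
      -- The right-hand sides lie in the range of `A`, so each equation puts `X (u i)` in that
      -- range; the extra equation with value 0 at `i = q` does this for the last vector `u q`.
      obtain ⟨u, hu⟩ := hs fun i => if i < q then A (v i) else 0
      have hmem : ∀ i ≤ q, u i ∈ M' := by
        intro i hi
        have h := hu i (by omega)
        by_cases hiq : i < q
        · rw [if_pos hiq] at h
          exact ⟨v i - u (i + 1), by rw [map_sub, ← h]; abel⟩
        · rw [if_neg hiq] at h
          exact ⟨- u (i + 1), by rw [map_neg]; exact (eq_neg_of_add_eq_zero_left h).symm⟩
      refine ⟨fun i => if h : i ≤ q then ⟨u i, hmem i h⟩ else 0, fun i hi => hA ?_⟩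
      rw [map_add, hX']
      have h := hu i (by omega)
      rw [if_pos hi] at h
      simp only [dif_pos hi.le, dif_pos (show i + 1 ≤ q by omega)]
      exact h) (by
      intro u hu i hiq
      -- A solution for the derived pencil extends by one more term, chosen to satisfy the equation
      -- at `i = q + 1`.
      have := hi (fun i => if i ≤ q + 1 then (u i : M) else - X' (u (q + 1))) (by
        intro i hi
        rw [if_pos hi]
        by_cases h : i = q + 1
        · subst h
          simp [hX']
        · have h₁ := hu i (by omega)
          rw [if_pos (by omega), ← hX', ← map_add]
          exact (congrArg A h₁).trans (map_zero A)) i (by omega)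
      rw [if_pos hiq] at this
      exact Subtype.ext this)
    -- Each chain of `M` is mapped to `W` by `X`, preceded by the `A`-image of its first vector.
    -- Since `X` on the chain of `M'` equals `A ∘ X'`, the `A`-images of the other vectors are
    -- already in this list.
    let F : (Σ i, Fin (d i + 1 + 1)) → W := fun x =>
      Fin.cases (A (f' ⟨x.1, 0⟩)) (fun j => X (f' ⟨x.1, j⟩)) x.2
    have hF₁ : ∀ i j, F ⟨i, Fin.succ j⟩ = X (f' ⟨i, j⟩) := fun i j => rfl
    have hFA : ∀ i (j : Fin (d i + 1)), F ⟨i, j.castSucc⟩ = A (f' ⟨i, j⟩) := by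
      intro i j
      induction j using Fin.cases with
      | zero => rfl
      | succ j =>
        rw [← Fin.succ_castSucc, hF₁, ← hAe, ← hXe, hX']
        rfl
    have hspan : ⊤ ≤ Submodule.span K (Set.range F) := by
      have h₁ : LinearMap.range A ≤ Submodule.span K (Set.range F) := by
        rw [LinearMap.range_eq_map, ← f'.span_eq, Submodule.map_span, Submodule.span_le]
        rintro _ ⟨_, ⟨⟨i, j⟩, rfl⟩, rfl⟩
        exact Submodule.subset_span ⟨⟨i, j.castSucc⟩, hFA i j⟩
      have h₂ : LinearMap.range X ≤ Submodule.span K (Set.range F) := by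
        rw [LinearMap.range_eq_map, ← f'.span_eq, Submodule.map_span, Submodule.span_le]
        rintro _ ⟨_, ⟨⟨i, j⟩, rfl⟩, rfl⟩
        exact Submodule.subset_span ⟨⟨i, j.succ⟩, rfl⟩
      intro w _
      obtain ⟨u, v, rfl⟩ := hXA w
      exact add_mem (h₂ ⟨u, rfl⟩) (h₁ ⟨v, rfl⟩)
    -- The map from `M` to `W / A M` induced by `X` is onto with kernel `M'`, so `dim W = 2 dim M -
    -- dim M'`.
    have hcard : Fintype.card (Σ i, Fin (d i + 1 + 1)) = finrank K W := by
      have c₁ : ∑ i, d i = finrank K M' := by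
        rw [finrank_eq_card_basis e']; simp
      have c₂ : ∑ i, (d i + 1) = finrank K M := by
        rw [finrank_eq_card_basis f']; simp
      let π := (LinearMap.range A).mkQ ∘ₗ X
      have hπ : LinearMap.ker π = M' := by
        ext u
        simp [π, M']
      have hπs : LinearMap.range π = ⊤ := by
        rw [LinearMap.range_eq_top]
        intro y
        obtain ⟨w, rfl⟩ := Submodule.mkQ_surjective _ y
        obtain ⟨u, v, rfl⟩ := hXA w
        refine ⟨u, ?_⟩
        simp [π]
      have c₃ := π.finrank_range_add_finrank_ker
      rw [hπ, hπs, finrank_top] at c₃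
      have c₄ := (LinearMap.range A).finrank_quotient_add_finrank
      rw [LinearMap.finrank_range_of_inj hA] at c₄
      simp only [Fintype.card_sigma, Fintype.card_fin]
      simp only [Finset.sum_add_distrib] at c₂ ⊢
      omega
    refine ⟨ι, ‹_›, fun i => d i + 1, f', basisOfTopLeSpanOfCardEqFinrank F hspan hcard, ?_, ?_, ?_⟩
    · intro i
      simpa using hd i
    · intro i j
      rw [coe_basisOfTopLeSpanOfCardEqFinrank]
      exact (hFA i j).symm
    · intro i j
      rw [coe_basisOfTopLeSpanOfCardEqFinrank]
      exact (hF₁ i j).symm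

end Chains

/-! ### Symmetric and skew-symmetric matrices and the pencil of forms -/

section Forms

open Module

variable {K : Type*} [Field K] {I J I' J' : Type*}

/-- The space of symmetric (`ε = 1`) or skew-symmetric (`ε = -1`) matrices. -/
def epsSym (K : Type*) [Field K] (ε : ℤˣ) (I : Type*) : Submodule K (Matrix I I K) where
  carrier := {S | ∀ i j, S j i = ((ε : ℤ) : K) * S i j}
  add_mem' hS hT i j := by simp [hS i j, hT i j, mul_add]
  zero_mem' i j := by simp
  smul_mem' c S hS i j := by simp [hS i j, mul_left_comm]

theorem mem_epsSym_iff_transpose {ε : ℤˣ} {S : Matrix I I K} :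
    S ∈ epsSym K ε I ↔ S.transpose = ((ε : ℤ) : K) • S := by
  rw [← Matrix.ext_iff]
  rfl

theorem units_mul_self (ε : ℤˣ) (x : K) : ((ε : ℤ) : K) * (((ε : ℤ) : K) * x) = x := by
  obtain rfl | rfl := Int.units_eq_one_or ε <;> simp

/-- Left multiplication by `X`, on symmetric or skew-symmetric matrices. -/
def leftPencil [Fintype I] (ε : ℤˣ) (X : Matrix J I K) : epsSym K ε I →ₗ[K] Matrix J I K where
  toFun S := X * S.1
  map_add' S T := by simp [Matrix.mul_add]
  map_smul' c S := by simp

/-- Congruence by a matrix with a left inverse, on symmetric or skew-symmetric matrices. -/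
def epsSymCongr [Fintype I] [Fintype I'] [DecidableEq I] [DecidableEq I'] (ε : ℤˣ)
    (P : Matrix I' I K) (P' : Matrix I I' K)
    (h : P * P' = 1) (h' : P' * P = 1) : epsSym K ε I ≃ₗ[K] epsSym K ε I' where
  toFun S := ⟨P * S.1 * P.transpose, by
    rw [mem_epsSym_iff_transpose, Matrix.transpose_mul, Matrix.transpose_mul,
      mem_epsSym_iff_transpose.1 S.2]
    simp [Matrix.mul_assoc]⟩
  map_add' S T := by ext1; simp [Matrix.mul_add, Matrix.add_mul]
  map_smul' c S := by ext1; simp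
  invFun S := ⟨P' * S.1 * P'.transpose, by
    rw [mem_epsSym_iff_transpose, Matrix.transpose_mul, Matrix.transpose_mul,
      mem_epsSym_iff_transpose.1 S.2]
    simp [Matrix.mul_assoc]⟩
  left_inv S := by
    ext1
    calc P' * (P * S.1 * P.transpose) * P'.transpose
        = (P' * P) * S.1 * (P.transpose * P'.transpose) := by simp only [Matrix.mul_assoc]
      _ = S.1 := by rw [← Matrix.transpose_mul, h']; simp
  right_inv S := by
    ext1
    calc P * (P' * S.1 * P'.transpose) * P.transpose
        = (P * P') * S.1 * (P'.transpose * P.transpose) := by simp only [Matrix.mul_assoc]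
      _ = S.1 := by rw [← Matrix.transpose_mul, h]; simp

/-- Multiplication by invertible matrices on both sides. -/
def matrixCongr [Fintype I] [Fintype I'] [DecidableEq I] [DecidableEq I']
    [Fintype J] [Fintype J'] [DecidableEq J] [DecidableEq J']
    (P : Matrix I' I K) (P' : Matrix I I' K) (h : P * P' = 1) (h' : P' * P = 1)
    (Q : Matrix J' J K) (Q' : Matrix J J' K) (k : Q * Q' = 1) (k' : Q' * Q = 1) :
    Matrix J I K ≃ₗ[K] Matrix J' I' K where
  toFun S := Q * S * P.transpose
  map_add' S T := by simp [Matrix.mul_add, Matrix.add_mul]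
  map_smul' c S := by simp
  invFun S := Q' * S * P'.transpose
  left_inv S := by
    calc Q' * (Q * S * P.transpose) * P'.transpose
        = (Q' * Q) * S * (P.transpose * P'.transpose) := by simp only [Matrix.mul_assoc]
      _ = S := by rw [← Matrix.transpose_mul, h', k']; simp
  right_inv S := by
    calc Q * (Q' * S * P'.transpose) * P.transpose
        = (Q * Q') * S * (P'.transpose * P.transpose) := by simp only [Matrix.mul_assoc]
      _ = S := by rw [← Matrix.transpose_mul, h, k]; simp

/-- From `Q Y = Y' P` follows `Y P' = Q' Y'`, hence `Y (P' S P'ᵀ) = Q' (Y' S) P'ᵀ`: congruence on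
the source and two-sided multiplication on the target intertwine the two pencils of forms. -/
theorem HasBlocks.leftPencil_of_equiv [Fintype I] [Fintype I'] [DecidableEq I] [DecidableEq I']
    [Fintype J] [Fintype J'] [DecidableEq J] [DecidableEq J'] {ε : ℤˣ}
    {X A : Matrix J I K} {X' A' : Matrix J' I' K} {s : Multiset (Block K)}
    (hs : HasBlocks (leftPencil ε X') (leftPencil ε A') s)
    (P : Matrix I' I K) (P' : Matrix I I' K) (h : P * P' = 1) (h' : P' * P = 1)
    (Q : Matrix J' J K) (Q' : Matrix J J' K) (k : Q * Q' = 1) (k' : Q' * Q = 1)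
    (hX : Q * X = X' * P) (hA : Q * A = A' * P) :
    HasBlocks (leftPencil ε X) (leftPencil ε A) s := by
  have key : ∀ {Y : Matrix J I K} {Y' : Matrix J' I' K}, Q * Y = Y' * P → Y * P' = Q' * Y' := by
    intro Y Y' hY
    calc Y * P' = (Q' * Q) * Y * P' := by rw [k', Matrix.one_mul]
      _ = Q' * (Y' * P) * P' := by rw [Matrix.mul_assoc Q', hY]
      _ = Q' * Y' * (P * P') := by simp only [Matrix.mul_assoc]
      _ = Q' * Y' := by rw [h, Matrix.mul_one]
  have key₂ : ∀ {Y : Matrix J I K} {Y' : Matrix J' I' K}, Q * Y = Y' * P →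
      ∀ S : epsSym K ε I', leftPencil ε Y (epsSymCongr ε P' P h' h S) =
        matrixCongr P' P h' h Q' Q k' k (leftPencil ε Y' S) := by
    intro Y Y' hY S
    change Y * (P' * S.1 * P'.transpose) = Q' * (Y' * S.1) * P'.transpose
    rw [← Matrix.mul_assoc, ← Matrix.mul_assoc, key hY]
    simp only [Matrix.mul_assoc]
  exact hs.of_equiv (epsSymCongr ε P' P h' h) (matrixCongr P' P h' h Q' Q k' k) (key₂ hX)
    (key₂ hA)

/-- Pairs of indices that parametrize the independent entries of a symmetric (`ε = 1`) or
skew-symmetric (`ε = -1`) matrix. -/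
abbrev IndexPair (ε : ℤˣ) (ι : Type*) [LinearOrder ι] : Type _ :=
  {P : ι × ι // P.1 < P.2 ∨ ε = 1 ∧ P.1 = P.2}

section Pairs

variable {ι : Type*} [LinearOrder ι] (ε : ℤˣ)

/-- Doubling the sum over independent pairs counts each ordered off-diagonal pair once and each
diagonal pair `1 + ε` times. -/
theorem two_mul_sum_indexPair [Fintype ι] (φ : ι → ι → ℤ) (hφ : ∀ i j, φ i j = φ j i) :
    2 * ∑ P : IndexPair ε ι, φ P.1.1 P.1.2 = ∑ i, ∑ j, φ i j + ε * ∑ i, φ i i := by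
  have h₀ : ∑ P : IndexPair ε ι, φ P.1.1 P.1.2 =
      ∑ i, ∑ j, if i < j ∨ ε = 1 ∧ i = j then φ i j else 0 := by
    rw [← Fintype.sum_prod_type' (f := fun i j => if i < j ∨ ε = 1 ∧ i = j then φ i j else 0),
      ← Finset.sum_filter, ← Finset.sum_subtype_eq_sum_filter]
    simp [Finset.sum_subtype]
  have h₁ : ∑ i, ∑ j, (if i < j ∨ ε = 1 ∧ i = j then φ i j else 0) =
      ∑ i, ∑ j, (if j < i ∨ ε = 1 ∧ i = j then φ i j else 0) := by
    rw [Finset.sum_comm]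
    refine Finset.sum_congr rfl fun i _ => Finset.sum_congr rfl fun j _ => ?_
    simp only [hφ j i, eq_comm (a := j)]
  have h₂ : ∑ i, φ i i = ∑ i, ∑ j, if i = j then φ i j else 0 := by simp
  rw [two_mul, h₀]
  nth_rewrite 2 [h₁]
  rw [h₂, Finset.mul_sum, ← Finset.sum_add_distrib, ← Finset.sum_add_distrib]
  refine Finset.sum_congr rfl fun i _ => ?_
  rw [Finset.mul_sum, ← Finset.sum_add_distrib, ← Finset.sum_add_distrib]
  refine Finset.sum_congr rfl fun j _ => ?_
  obtain rfl | rfl := Int.units_eq_one_or ε <;>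
    obtain h | rfl | h := lt_trichotomy i j <;>
      simp [*, ne_of_lt, ne_of_gt, not_lt_of_gt]

variable {ε}

/-- The entry of the symmetric or skew-symmetric matrix with given independent entries. -/
def pairVal (f : IndexPair ε ι → K) (i j : ι) : K :=
  if h : i < j ∨ ε = 1 ∧ i = j then f ⟨(i, j), h⟩
  else if h : j < i ∨ ε = 1 ∧ j = i then ((ε : ℤ) : K) * f ⟨(j, i), h⟩ else 0

theorem pairVal_of_mem (f : IndexPair ε ι → K) (P : IndexPair ε ι) :
    pairVal f P.1.1 P.1.2 = f P := dif_pos P.2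

theorem pairVal_swap (f : IndexPair ε ι → K) (i j : ι) :
    pairVal f j i = ((ε : ℤ) : K) * pairVal f i j := by
  unfold pairVal
  obtain rfl | rfl := Int.units_eq_one_or ε <;>
    obtain h | rfl | h := lt_trichotomy i j <;>
      simp [*, ne_of_lt, ne_of_gt, not_lt_of_gt]

theorem pairVal_add (f g : IndexPair ε ι → K) (i j : ι) :
    pairVal (f + g) i j = pairVal f i j + pairVal g i j := by
  unfold pairVal
  split_ifs <;> simp [mul_add]

theorem pairVal_smul (c : K) (f : IndexPair ε ι → K) (i j : ι) :
    pairVal (c • f) i j = c * pairVal f i j := by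
  unfold pairVal
  split_ifs <;> simp [mul_left_comm]

theorem pairVal_congr {f g : IndexPair ε ι → K} {i j : ι}
    (h : ∀ P : IndexPair ε ι, (P.1 = (i, j) ∨ P.1 = (j, i)) → f P = g P) :
    pairVal f i j = pairVal g i j := by
  unfold pairVal
  split_ifs with h₁ h₂
  · exact h _ (Or.inl rfl)
  · rw [h _ (Or.inr rfl)]
  · rfl

/-- Two symmetric or skew-symmetric functions agree if they agree on independent entries. -/
theorem eq_of_forall_indexPair [CharZero K] {S T : ι → ι → K}
    (hS : ∀ i j, S j i = ((ε : ℤ) : K) * S i j) (hT : ∀ i j, T j i = ((ε : ℤ) : K) * T i j)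
    (h : ∀ P : IndexPair ε ι, S P.1.1 P.1.2 = T P.1.1 P.1.2) (i j : ι) : S i j = T i j := by
  obtain hij | rfl | hij := lt_trichotomy i j
  · exact h ⟨(i, j), Or.inl hij⟩
  · obtain rfl | rfl := Int.units_eq_one_or ε
    · exact h ⟨(i, i), Or.inr ⟨rfl, rfl⟩⟩
    · have h₁ := hS i i
      have h₂ := hT i i
      simp only [Units.val_neg, Units.val_one, Int.cast_neg, Int.cast_one, neg_mul, one_mul,
        self_eq_neg] at h₁ h₂
      rw [h₁, h₂]
  · rw [hS j i, hT j i, h ⟨(j, i), Or.inl hij⟩]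

end Pairs

/-- The independent entries are coordinates; characteristic zero makes the diagonal of a skew matrix
vanish. The formula is doubled to avoid division. -/
theorem two_mul_finrank_epsSym [CharZero K] (ε : ℤˣ) [Fintype I] :
    2 * (finrank K (epsSym K ε I) : ℤ) =
      Fintype.card I * Fintype.card I + ε * Fintype.card I := by
  let _ : LinearOrder I := LinearOrder.lift' (Fintype.equivFin I) (Fintype.equivFin I).injective
  let e : epsSym K ε I ≃ₗ[K] (IndexPair ε I → K) :=
    { toFun := fun S P => S.1 P.1.1 P.1.2
      map_add' := fun _ _ => rfl
      map_smul' := fun _ _ => rfl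
      invFun := fun f => ⟨Matrix.of fun i j => pairVal f i j, pairVal_swap f⟩
      left_inv := fun S => by
        ext i j
        exact eq_of_forall_indexPair (pairVal_swap _) S.2 (fun P => pairVal_of_mem _ P) i j
      right_inv := fun f => funext fun P => pairVal_of_mem f P }
  have h := two_mul_sum_indexPair ε (fun _ _ : I => 1) fun _ _ => rfl
  rw [e.finrank_eq, finrank_fintype_fun_eq_card]
  simpa using h

end Forms

/-! ### The pencil of forms on a sum of chains: Hankel part and hook part -/

section ChainPencil

open Module

variable {K : Type*} [Field K] {ι : Type}

/-- The row matrix of `e⟨i, j⟩ ↦ f⟨i, j + 1⟩`. -/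
def succMatrix (K : Type*) [Field K] [DecidableEq ι] (d : ι → ℕ) :
    Matrix (Σ i, Fin (d i)) (Σ i, Fin (d i + 1)) K :=
  Matrix.of fun x y => if (⟨x.1, x.2.succ⟩ : Σ i, Fin (d i + 1)) = y then 1 else 0

/-- The row matrix of `e⟨i, j⟩ ↦ f⟨i, j⟩`. -/
def castMatrix (K : Type*) [Field K] [DecidableEq ι] (d : ι → ℕ) :
    Matrix (Σ i, Fin (d i)) (Σ i, Fin (d i + 1)) K :=
  Matrix.of fun x y => if (⟨x.1, x.2.castSucc⟩ : Σ i, Fin (d i + 1)) = y then 1 else 0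

theorem leftPencil_succMatrix_apply [Fintype ι] [DecidableEq ι] (d : ι → ℕ) {ε : ℤˣ}
    (S : epsSym K ε (Σ i, Fin (d i + 1))) (i : ι) (a : Fin (d i)) (y : Σ i, Fin (d i + 1)) :
    leftPencil ε (succMatrix K d) S ⟨i, a⟩ y = S.1 ⟨i, a.succ⟩ y := by
  change (succMatrix K d * S.1) _ _ = _
  simp [Matrix.mul_apply, succMatrix]

theorem leftPencil_castMatrix_apply [Fintype ι] [DecidableEq ι] (d : ι → ℕ) {ε : ℤˣ}
    (S : epsSym K ε (Σ i, Fin (d i + 1))) (i : ι) (a : Fin (d i)) (y : Σ i, Fin (d i + 1)) :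
    leftPencil ε (castMatrix K d) S ⟨i, a⟩ y = S.1 ⟨i, a.castSucc⟩ y := by
  change (castMatrix K d * S.1) _ _ = _
  simp [Matrix.mul_apply, castMatrix]

section Hankel

variable [LinearOrder ι] {ε : ℤˣ}

/-- The entries, constant along antidiagonals, of the blocks of a block Hankel matrix. -/
def hankelVal {k : IndexPair ε ι → ℕ} (f : ∀ P, Fin (k P) → K) (i j : ι) (c : ℕ) : K :=
  pairVal (fun P => if h : c < k P then f P ⟨c, h⟩ else 0) i j

variable {k : IndexPair ε ι → ℕ}

theorem hankelVal_swap (f : ∀ P, Fin (k P) → K) (i j : ι) (c : ℕ) :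
    hankelVal f j i c = ((ε : ℤ) : K) * hankelVal f i j c := pairVal_swap _ _ _

theorem hankelVal_add (f g : ∀ P, Fin (k P) → K) (i j : ι) (c : ℕ) :
    hankelVal (f + g) i j c = hankelVal f i j c + hankelVal g i j c := by
  unfold hankelVal
  rw [← pairVal_add]
  congr 1
  funext P
  by_cases h : c < k P <;> simp [h]

theorem hankelVal_smul (r : K) (f : ∀ P, Fin (k P) → K) (i j : ι) (c : ℕ) :
    hankelVal (r • f) i j c = r * hankelVal f i j c := by
  unfold hankelVal
  rw [← pairVal_smul]
  congr 1
  funext P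
  by_cases h : c < k P <;> simp [h]

theorem hankelVal_zero (i j : ι) (c : ℕ) :
    hankelVal (0 : ∀ P, Fin (k P) → K) i j c = 0 := by
  have := hankelVal_smul (0 : K) (0 : ∀ P, Fin (k P) → K) i j c
  simpa using this

theorem hankelVal_of_lt (f : ∀ P, Fin (k P) → K) (P : IndexPair ε ι) {c : ℕ} (h : c < k P) :
    hankelVal f P.1.1 P.1.2 c = f P ⟨c, h⟩ := by
  rw [hankelVal, pairVal_of_mem, dif_pos h]

theorem hankelVal_shiftSucc (f : ∀ P, Fin (k P + 1) → K) (i j : ι) (c : ℕ) :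
    hankelVal (shiftSucc k f) i j c = hankelVal f i j (c + 1) := by
  refine pairVal_congr fun P _ => ?_
  by_cases h : c < k P <;> simp [h, shiftSucc]

/-- The hypothesis excludes the antidiagonal `c = k P`, where `f` still has an entry while its
truncation is padded by zero. -/
theorem hankelVal_shiftCast (f : ∀ P, Fin (k P + 1) → K) (i j : ι) (c : ℕ)
    (h : ∀ P : IndexPair ε ι, (P.1 = (i, j) ∨ P.1 = (j, i)) → c < k P) :
    hankelVal (shiftCast k f) i j c = hankelVal f i j c := by
  refine pairVal_congr fun P hP => ?_
  have := h P hP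
  simp [this, this.trans (Nat.lt_succ_self _), shiftCast]

end Hankel

variable [LinearOrder ι] (ε : ℤˣ) (d : ι → ℕ)

/-- The horizontal minimal index of the pencil of forms on a pair of chains. -/
def pairWidth (P : IndexPair ε ι) : ℕ := d P.1.1 + d P.1.2

/-- The block Hankel matrix with given antidiagonal values. -/
def hankelForm : (∀ P : IndexPair ε ι, Fin (pairWidth ε d P + 1) → K) →ₗ[K]
    epsSym K ε (Σ i, Fin (d i + 1)) where
  toFun f := ⟨Matrix.of fun x y => hankelVal f x.1 y.1 (x.2 + y.2), fun x y => by
    simpa [add_comm] using hankelVal_swap f x.1 y.1 (x.2 + y.2)⟩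
  map_add' f g := Subtype.ext (Matrix.ext fun _ _ => hankelVal_add f g _ _ _)
  map_smul' c f := Subtype.ext (Matrix.ext fun _ _ => hankelVal_smul c f _ _ _)

/-- The part of a block Hankel matrix in the range of the pencil of forms. -/
def hankelRange : (∀ P : IndexPair ε ι, Fin (pairWidth ε d P) → K) →ₗ[K]
    Matrix (Σ i, Fin (d i)) (Σ i, Fin (d i + 1)) K where
  toFun f := Matrix.of fun x y => hankelVal f x.1 y.1 (x.2 + y.2)
  map_add' f g := by ext; exact hankelVal_add _ _ _ _ _
  map_smul' c f := by ext; exact hankelVal_smul _ _ _ _ _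

/-- The forms that vanish on the first row and the last column of every independent block. -/
def hookForms (K : Type*) [Field K] :
    Submodule K (Matrix (Σ i, Fin (d i + 1)) (Σ i, Fin (d i + 1)) K) where
  carrier := {S | S ∈ epsSym K ε (Σ i, Fin (d i + 1)) ∧ ∀ P : IndexPair ε ι,
    (∀ b, S ⟨P.1.1, 0⟩ ⟨P.1.2, b⟩ = 0) ∧ ∀ a, S ⟨P.1.1, a⟩ ⟨P.1.2, Fin.last _⟩ = 0}
  add_mem' hS hT := ⟨add_mem hS.1 hT.1, fun P =>
    ⟨fun b => by simp [(hS.2 P).1, (hT.2 P).1], fun a => by simp [(hS.2 P).2, (hT.2 P).2]⟩⟩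
  zero_mem' := ⟨zero_mem _, fun P => by simp⟩
  smul_mem' c S hS := ⟨Submodule.smul_mem _ c hS.1, fun P =>
    ⟨fun b => by simp [(hS.2 P).1], fun a => by simp [(hS.2 P).2]⟩⟩

/-- The inclusion of the forms that vanish on the hooks. -/
def hookIncl (K : Type*) [Field K] : hookForms ε d K →ₗ[K] epsSym K ε (Σ i, Fin (d i + 1)) :=
  Submodule.inclusion fun _ hS => hS.1

variable {ε d}

theorem lt_pairWidth_row (P : IndexPair ε ι) (b : Fin (d P.1.2 + 1)) :
    (b : ℕ) < pairWidth ε d P + 1 := by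
  unfold pairWidth
  omega

theorem lt_pairWidth_col (P : IndexPair ε ι) (a : Fin (d P.1.1 + 1)) :
    (a : ℕ) + d P.1.2 < pairWidth ε d P + 1 := by
  unfold pairWidth
  omega

theorem hankelForm_hook_row (f : ∀ P : IndexPair ε ι, Fin (pairWidth ε d P + 1) → K)
    (P : IndexPair ε ι) (b : Fin (d P.1.2 + 1)) :
    (hankelForm ε d f).1 ⟨P.1.1, 0⟩ ⟨P.1.2, b⟩ = f P ⟨b, lt_pairWidth_row P b⟩ :=
  (congrArg (hankelVal f P.1.1 P.1.2) (by simp)).trans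
    (hankelVal_of_lt f P (lt_pairWidth_row P b))

theorem hankelForm_hook_col (f : ∀ P : IndexPair ε ι, Fin (pairWidth ε d P + 1) → K)
    (P : IndexPair ε ι) (a : Fin (d P.1.1 + 1)) :
    (hankelForm ε d f).1 ⟨P.1.1, a⟩ ⟨P.1.2, Fin.last _⟩ =
      f P ⟨a + d P.1.2, lt_pairWidth_col P a⟩ :=
  (congrArg (hankelVal f P.1.1 P.1.2) (by simp)).trans
    (hankelVal_of_lt f P (lt_pairWidth_col P a))

/-- The hook runs along the first row and then down the last column, crossing each antidiagonal
exactly once. So a Hankel block is determined by arbitrary values on its hook, and subtracting it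
clears the hook of any form. -/
theorem bijective_hankelForm_add : Function.Bijective
    ((hankelForm ε d).coprod (hookIncl ε d K)) := by
  constructor
  · rw [injective_iff_map_eq_zero]
    rintro ⟨f, s⟩ h
    rw [LinearMap.coprod_apply] at h
    have hxy : ∀ x y, (hankelForm ε d f).1 x y + s.1 x y = 0 := fun x y =>
      congrFun (congrFun (congrArg Subtype.val h) x) y
    have hf : f = 0 := by
      funext P c
      by_cases hc : (c : ℕ) < d P.1.2 + 1
      · have := hxy ⟨P.1.1, 0⟩ ⟨P.1.2, ⟨c, hc⟩⟩
        rwa [(s.2.2 P).1, add_zero, hankelForm_hook_row] at this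
      · have hc' := c.2
        unfold pairWidth at hc'
        have := hxy ⟨P.1.1, ⟨c - d P.1.2, by omega⟩⟩ ⟨P.1.2, Fin.last _⟩
        rw [(s.2.2 P).2, add_zero, hankelForm_hook_col] at this
        refine Eq.trans (congrArg (f P) (Fin.ext ?_)) this
        simp only
        omega
    subst hf
    rw [map_zero, zero_add] at h
    rw [Prod.mk_eq_zero]
    exact ⟨rfl, Subtype.ext (congrArg (fun S => S.1) h :)⟩
  · intro S
    let f : ∀ P : IndexPair ε ι, Fin (pairWidth ε d P + 1) → K := fun P c =>
      if hc : (c : ℕ) < d P.1.2 + 1 then S.1 ⟨P.1.1, 0⟩ ⟨P.1.2, ⟨c, hc⟩⟩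
      else S.1 ⟨P.1.1, ⟨c - d P.1.2, by have := c.2; unfold pairWidth at this; omega⟩⟩
        ⟨P.1.2, Fin.last _⟩
    refine ⟨(f, ⟨S.1 - (hankelForm ε d f).1, sub_mem S.2 (hankelForm ε d f).2, fun P => ⟨fun b => ?_, fun a => ?_⟩⟩), Subtype.ext (add_sub_cancel _ _)⟩
    · change S.1 _ _ - (hankelForm ε d f).1 _ _ = 0
      rw [hankelForm_hook_row, sub_eq_zero]
      exact (dif_pos (c := (b : ℕ) < d P.1.2 + 1) b.2 (t := fun hc => S.1 ⟨P.1.1, 0⟩ ⟨P.1.2, ⟨b, hc⟩⟩)).symm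
    · change S.1 _ _ - (hankelForm ε d f).1 _ _ = 0
      rw [hankelForm_hook_col, sub_eq_zero]
      -- The corner lies on both arms of the hook, and `f` reads it from the first row.
      by_cases ha : a = 0
      · subst ha
        refine Eq.trans ?_ (dif_pos (show (((0 : Fin (d P.1.1 + 1)) : ℕ) + d P.1.2) <
          d P.1.2 + 1 by simp)).symm
        exact congrArg (fun b => S.1 ⟨P.1.1, 0⟩ ⟨P.1.2, b⟩) (Fin.ext (by simp))
      · have ha' : (a : ℕ) ≠ 0 := fun h => ha (Fin.ext h)
        refine Eq.trans ?_ (dif_neg (show ¬ ((a : ℕ) + d P.1.2) < d P.1.2 + 1 by omega)).symm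
        exact congrArg (fun a => S.1 ⟨P.1.1, a⟩ ⟨P.1.2, Fin.last _⟩) (Fin.ext (by simp))

/-- A skew-symmetric Hankel family, or one that vanishes on the hooks, is zero. -/
theorem hookForm_eq_zero_of_hankel [CharZero K] (s : hookForms ε d K)
    (h : ∀ i j (a : Fin (d i)) (b : Fin (d j)),
      s.1 ⟨i, a.succ⟩ ⟨j, b.castSucc⟩ = s.1 ⟨i, a.castSucc⟩ ⟨j, b.succ⟩) : s = 0 := by
  -- An entry can be moved up and to the right along its antidiagonal until it meets the hook, where
  -- it is zero.
  have hP : ∀ P : IndexPair ε ι, ∀ n (a : Fin (d P.1.1 + 1)) (b : Fin (d P.1.2 + 1)),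
      (a : ℕ) = n → s.1 ⟨P.1.1, a⟩ ⟨P.1.2, b⟩ = 0 := by
    intro P n
    induction n with
    | zero =>
      intro a b ha
      obtain rfl : a = 0 := Fin.ext ha
      exact (s.2.2 P).1 b
    | succ n ih =>
      intro a b ha
      induction b using Fin.lastCases with
      | last => exact (s.2.2 P).2 a
      | cast b =>
        induction a using Fin.cases with
        | zero => exact (s.2.2 P).1 _
        | succ a =>
          rw [h]
          exact ih _ _ (by simpa using ha)
  have hmove : ∀ i j n (a a' : Fin (d i + 1)) (b b' : Fin (d j + 1)), (a : ℕ) = a' + n →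
      (b' : ℕ) = b + n → s.1 ⟨i, a⟩ ⟨j, b⟩ = s.1 ⟨i, a'⟩ ⟨j, b'⟩ := by
    intro i j n
    induction n with
    | zero =>
      intro a a' b b' ha hb
      rw [show a = a' from Fin.ext ha, show b' = b from Fin.ext hb]
    | succ n ih =>
      intro a a' b b' ha hb
      have h₁ := h i j ⟨a' + n, by omega⟩ ⟨b, by omega⟩
      have ha' : a = Fin.succ ⟨a' + n, by omega⟩ := Fin.ext ha
      have hb' : b = Fin.castSucc ⟨b, by omega⟩ := Fin.ext rfl
      exact (congrArg₂ (fun a b => s.1 ⟨i, a⟩ ⟨j, b⟩) ha' hb').trans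
        (h₁.trans (ih _ _ _ _ (by simp) (by simp; omega)))
  -- Diagonal blocks have no hook condition when `ε = -1`; there the Hankel property forces
  -- symmetry, which together with skewness gives zero.
  have hsymm : ∀ i (a b : Fin (d i + 1)), s.1 ⟨i, a⟩ ⟨i, b⟩ = s.1 ⟨i, b⟩ ⟨i, a⟩ := by
    intro i a b
    obtain hab | hab := le_total (a : ℕ) b
    · exact (hmove i i (b - a) b a a b (by omega) (by omega)).symm
    · exact hmove i i (a - b) a b b a (by omega) (by omega)
  ext ⟨i, a⟩ ⟨j, b⟩
  change s.1 _ _ = 0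
  obtain hij | rfl | hij := lt_trichotomy i j
  · exact hP ⟨(i, j), Or.inl hij⟩ _ a b rfl
  · obtain rfl | rfl := Int.units_eq_one_or ε
    · exact hP ⟨(i, i), Or.inr ⟨rfl, rfl⟩⟩ _ a b rfl
    · have h₁ := s.2.1 ⟨i, a⟩ ⟨i, b⟩
      rw [hsymm] at h₁
      exact self_eq_neg.1 (by simpa using h₁)
  · rw [s.2.1 ⟨j, b⟩ ⟨i, a⟩, hP ⟨(j, i), Or.inl hij⟩ _ b a rfl, mul_zero]

variable [Fintype ι]

/-- The pencil of forms applied to a block Hankel part and two forms vanishing on the hooks. -/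
def hookRange (ε : ℤˣ) (d : ι → ℕ) :
    ((∀ P : IndexPair ε ι, Fin (pairWidth ε d P) → K) × (hookForms ε d K × hookForms ε d K)) →ₗ[K]
      Matrix (Σ i, Fin (d i)) (Σ i, Fin (d i + 1)) K :=
  (hankelRange ε d).coprod ((leftPencil ε (castMatrix K d) ∘ₗ hookIncl ε d K).coprod
    (leftPencil ε (succMatrix K d) ∘ₗ hookIncl ε d K))

theorem hookRange_apply (g : ∀ P : IndexPair ε ι, Fin (pairWidth ε d P) → K)
    (s t : hookForms ε d K) (i : ι) (a : Fin (d i)) (y : Σ i, Fin (d i + 1)) :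
    hookRange ε d (g, (s, t)) ⟨i, a⟩ y = hankelVal g i y.1 (a + y.2) +
      (s.1 ⟨i, a.castSucc⟩ y + t.1 ⟨i, a.succ⟩ y) := by
  change hankelVal g i y.1 (a + y.2) + (leftPencil ε (castMatrix K d) (hookIncl ε d K s) ⟨i, a⟩ y +
    leftPencil ε (succMatrix K d) (hookIncl ε d K t) ⟨i, a⟩ y) = _
  rw [leftPencil_castMatrix_apply, leftPencil_succMatrix_apply]
  rfl

/-- The relation and its transpose (`h₁`, `h₂`), read on the hooks, force the Hankel part `g` to
vanish. Comparing them at entries sharing the same value of `s` shows that `t` is Hankel, hence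
zero; then the same holds for `s`. -/
theorem injective_hookRange [CharZero K] :
    Function.Injective (hookRange (K := K) ε d) := by
  rw [injective_iff_map_eq_zero]
  rintro ⟨g, s, t⟩ h
  have h₁ : ∀ i j (a : Fin (d i)) (b : Fin (d j + 1)), hankelVal g i j (a + b) +
      (s.1 ⟨i, a.castSucc⟩ ⟨j, b⟩ + t.1 ⟨i, a.succ⟩ ⟨j, b⟩) = 0 := by
    intro i j a b
    have := hookRange_apply g s t i a ⟨j, b⟩
    rw [h] at this
    exact this.symm
  have h₂ : ∀ i j (a : Fin (d i + 1)) (b : Fin (d j)), hankelVal g i j (a + b) +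
      (s.1 ⟨i, a⟩ ⟨j, b.castSucc⟩ + t.1 ⟨i, a⟩ ⟨j, b.succ⟩) = 0 := by
    intro i j a b
    have := h₁ j i b a
    rw [hankelVal_swap, s.2.1 ⟨i, a⟩, t.2.1 ⟨i, a⟩, ← mul_add, ← mul_add, add_comm (b : ℕ)] at this
    rw [← units_mul_self ε (_ + _), this, mul_zero]
  have hg : g = 0 := by
    funext P c
    rw [← hankelVal_of_lt g P c.2]
    by_cases hc : (c : ℕ) < d P.1.2
    · have := h₂ P.1.1 P.1.2 0 ⟨c, hc⟩
      rw [(s.2.2 P).1, (t.2.2 P).1] at this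
      simpa using this
    · have hc' := c.2
      unfold pairWidth at hc'
      have := h₁ P.1.1 P.1.2 ⟨c - d P.1.2, by omega⟩ (Fin.last _)
      rw [(s.2.2 P).2, (t.2.2 P).2] at this
      simpa [Nat.sub_add_cancel (not_lt.1 hc)] using this
  subst hg
  simp only [hankelVal_zero, zero_add] at h₁ h₂
  have ht : t = 0 := by
    refine hookForm_eq_zero_of_hankel t fun i j a b => ?_
    have e₁ := h₁ i j a b.castSucc
    have e₂ := h₂ i j a.castSucc b
    exact add_left_cancel (e₁.trans e₂.symm)
  subst ht
  have hs : s = 0 := by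
    refine hookForm_eq_zero_of_hankel s fun i j a b => ?_
    have e₁ := h₂ i j a.succ b
    have e₂ := h₁ i j a b.succ
    exact add_right_cancel (e₁.trans e₂.symm)
  subst hs
  rfl

/-- The hook forms have the dimension of all forms minus that of the Hankel forms. The second
identity equates the dimensions of source and target of `hookRange`, so its injectivity suffices for
an isomorphism. -/
theorem finrank_hookForms [CharZero K] :
    2 * (finrank K (hookForms ε d K) : ℤ) = (∑ i, d i : ℕ) * (∑ i, d i : ℕ) - ε * (∑ i, d i : ℕ) ∧
    Fintype.card (Σ i, Fin (d i)) * Fintype.card (Σ i, Fin (d i + 1)) =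
      ∑ P : IndexPair ε ι, pairWidth ε d P +
        (finrank K (hookForms ε d K) + finrank K (hookForms ε d K)) := by
  have e₁ := (LinearEquiv.ofBijective _ (bijective_hankelForm_add (K := K) (ε := ε) (d := d))).finrank_eq
  have e₂ := two_mul_finrank_epsSym (K := K) (I := Σ i, Fin (d i + 1)) ε
  have e₃ := two_mul_sum_indexPair ε (fun i j => ((d i + d j : ℕ) : ℤ)) fun i j => by
    rw [add_comm]
  have e₄ := two_mul_sum_indexPair ε (fun _ _ : ι => (1 : ℤ)) fun i j => rfl
  have e₅ : finrank K (∀ P : IndexPair ε ι, Fin (pairWidth ε d P + 1) → K) =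
      ∑ P : IndexPair ε ι, (pairWidth ε d P + 1) := by
    rw [finrank_pi_fintype]
    exact Finset.sum_congr rfl fun P _ => by simp
  rw [finrank_prod (R := K), e₅] at e₁
  rw [← e₁] at e₂
  have e₆ : Fintype.card (Σ i, Fin (d i + 1)) = ∑ i, d i + Fintype.card ι := by
    simp [Finset.sum_add_distrib]
  have e₇ : Fintype.card (Σ i, Fin (d i)) = ∑ i, d i := by simp
  rw [e₆] at e₂
  rw [e₆, e₇]
  have e₈ : (∑ P : IndexPair ε ι, (pairWidth ε d P + 1) : ℕ) =
      ∑ P : IndexPair ε ι, pairWidth ε d P + Fintype.card (IndexPair ε ι) := by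
    simp [Finset.sum_add_distrib]
  have e₉ : ∑ P : IndexPair ε ι, ((d P.1.1 + d P.1.2 : ℕ) : ℤ) =
      (∑ P : IndexPair ε ι, pairWidth ε d P : ℕ) := by
    rw [Nat.cast_sum]
    rfl
  rw [e₉] at e₃
  rw [e₈] at e₂
  have e₁₀ : ∑ i, ∑ j, ((d i + d j : ℕ) : ℤ) = 2 * (Fintype.card ι * ∑ i, d i : ℕ) := by
    push_cast [Finset.sum_add_distrib]
    simp [Finset.mul_sum, two_mul, Finset.sum_add_distrib]
  have e₁₁ : ∑ i, ((d i + d i : ℕ) : ℤ) = 2 * (∑ i, d i : ℕ) := by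
    push_cast [Finset.sum_add_distrib]
    ring
  have e₁₂ : 2 * (Fintype.card (IndexPair ε ι) : ℤ) =
      Fintype.card ι * Fintype.card ι + ε * Fintype.card ι := by
    simpa using e₄
  rw [e₁₀, e₁₁] at e₃
  generalize ∑ P : IndexPair ε ι, pairWidth ε d P = w at *
  generalize Fintype.card (IndexPair ε ι) = c at *
  generalize ∑ i, d i = m at *
  generalize Fintype.card ι = p at *
  generalize finrank K (hookForms ε d K) = u at *
  push_cast at e₂ e₃
  have e₁₃ : 2 * (u : ℤ) = m * m - ε * m := by linear_combination e₂ - e₃ - e₁₂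
  refine ⟨e₁₃, ?_⟩
  zify
  have e₁₄ : (w : ℤ) = p * m + ε * m := by linarith
  linear_combination -e₁₃ - e₁₄

/-- The Jordan–Kronecker normal form of the pencil of forms on a sum of chains. -/
theorem hasBlocks_leftPencil_chains [CharZero K] :
    HasBlocks (leftPencil ε (succMatrix K d)) (leftPencil ε (castMatrix K d))
      (Finset.univ.val.map (fun P : IndexPair ε ι => Block.horizontal (pairWidth ε d P)) +
        Multiset.replicate (finrank K (hookForms ε d K)) (Block.vertical 1)) := by
  refine ((hasBlocks_shift (pairWidth ε d)).prod hasBlocks_inr_inl).of_equiv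
    (LinearEquiv.ofBijective _ bijective_hankelForm_add)
    (LinearEquiv.ofInjectiveOfFinrankEq (hookRange ε d) injective_hookRange ?_) ?_ ?_
  · rw [finrank_matrix, finrank_prod, finrank_prod, finrank_self, mul_one,
      (finrank_hookForms (K := K) (ε := ε) (d := d)).2, finrank_pi_fintype]
    congr 1
    exact Finset.sum_congr rfl fun P _ => by simp
  · rintro ⟨f, s⟩
    ext ⟨i, a⟩ ⟨j, b⟩
    change leftPencil ε (succMatrix K d) (hankelForm ε d f + hookIncl ε d K s) ⟨i, a⟩ ⟨j, b⟩ =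
      hookRange ε d (shiftSucc _ f, (0, s)) ⟨i, a⟩ ⟨j, b⟩
    rw [leftPencil_succMatrix_apply, hookRange_apply, hankelVal_shiftSucc]
    change hankelVal f i j (_ + _) + s.1 _ _ = _ + (0 + s.1 _ _)
    rw [zero_add]
    congr 2
    simp
    omega
  · rintro ⟨f, s⟩
    ext ⟨i, a⟩ ⟨j, b⟩
    change leftPencil ε (castMatrix K d) (hankelForm ε d f + hookIncl ε d K s) ⟨i, a⟩ ⟨j, b⟩ =
      hookRange ε d (shiftCast _ f, (s, 0)) ⟨i, a⟩ ⟨j, b⟩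
    rw [leftPencil_castMatrix_apply, hookRange_apply, hankelVal_shiftCast]
    · change hankelVal f i j (_ + _) + s.1 _ _ = _ + (s.1 _ _ + 0)
      rw [add_zero]
      rfl
    -- The row index stays below `d i`, so the last antidiagonal `d i + d j` is never reached.
    · rintro ⟨P, hP⟩ (rfl | rfl)
      · simp only [pairWidth]; omega
      · simp only [pairWidth]; omega

end ChainPencil

/-! ### Generic wide matrices: `m < n` -/

section Wide

open Module

variable {K : Type*} [Field K] {I J : Type} [Fintype I] [Fintype J]

/-- The prolongation `(u₀, …, u_q) ↦ (uᵢ X + uᵢ₊₁ A)ᵢ` of a pencil of matrices acting on rows. -/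
def prolongation (K : Type*) [Field K] (I J : Type) [Fintype J] (q : ℕ) :
    Matrix J I K × Matrix J I K →ₗ[K] (Fin (q + 1) → J → K) →ₗ[K] (Fin q → I → K) :=
  LinearMap.mk₂ K (fun Y u i => Matrix.vecMul (u i.castSucc) Y.1 + Matrix.vecMul (u i.succ) Y.2)
    (fun Y Z u => by funext i; simp [Matrix.vecMul_add]; abel)
    (fun c Y u => by funext i; simp [Matrix.vecMul_smul])
    (fun Y u v => by funext i; simp [Matrix.add_vecMul]; abel)
    (fun c Y u => by funext i; simp [Matrix.smul_vecMul])

theorem prolongation_apply (q : ℕ) (X A : Matrix J I K) (u : Fin (q + 1) → J → K) (i : Fin q) :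
    prolongation K I J q (X, A) u i =
      Matrix.vecMul (u i.castSucc) X + Matrix.vecMul (u i.succ) A := rfl

section ShiftPair

variable {m n : ℕ}

/-- The coordinates of a vector, extended by zero. -/
def extendZero (g : J ≃ Fin m) (u : J → K) (k : ℕ) : K :=
  if h : k < m then u (g.symm ⟨k, h⟩) else 0

theorem extendZero_of_le (g : J ≃ Fin m) (u : J → K) {k : ℕ} (h : m ≤ k) :
    extendZero g u k = 0 := dif_neg h.not_gt

/-- The matrix that sends the `j`-th basis row to the `(j + p)`-th one. -/
def shiftMatrix (K : Type*) [Field K] (g : J ≃ Fin m) (h : I ≃ Fin n) (p : ℕ) : Matrix J I K :=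
  Matrix.of fun j i => if (g j : ℕ) + p = h i then 1 else 0

theorem vecMul_shiftMatrix (g : J ≃ Fin m) (h : I ≃ Fin n) (p : ℕ) (u : J → K) (i : I) :
    Matrix.vecMul u (shiftMatrix K g h p) i =
      if p ≤ (h i : ℕ) then extendZero g u (h i - p) else 0 := by
  simp only [Matrix.vecMul, dotProduct, shiftMatrix, Matrix.of_apply, mul_ite, mul_one, mul_zero]
  by_cases hk : p ≤ (h i : ℕ) ∧ (h i : ℕ) - p < m
  · rw [if_pos hk.1, extendZero, dif_pos hk.2, Finset.sum_eq_single (g.symm ⟨h i - p, hk.2⟩)]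
    · simp [Nat.sub_add_cancel hk.1]
    · intro j _ hj
      rw [if_neg]
      intro h'
      exact hj (g.injective (Fin.ext (by simp; omega)))
    · simp
  · rw [Finset.sum_eq_zero]
    · split_ifs with h'
      · rw [extendZero_of_le _ _ (by omega)]
      · rfl
    · intro j _
      rw [if_neg]
      intro h'
      have := (g j).2
      omega

/-- Shifted sequences: entries are pushed by `p` places and change sign. -/
structure IsShifted (U : ℕ → ℕ → K) (N p : ℕ) : Prop where
  low : ∀ i < N, ∀ k < p, U (i + 1) k = 0
  step : ∀ i < N, ∀ k, U (i + 1) (k + p) = - U i k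

/-- Up to sign, `U 0 k` reappears as `U c (k + c * p)`, so it vanishes once it has been pushed past
the end. -/
theorem IsShifted.zero_of_top {U : ℕ → ℕ → K} {N p : ℕ} (h : IsShifted U N p) :
    ∀ c ≤ N, ∀ k, U c (k + c * p) = 0 → U 0 k = 0 := by
  intro c
  induction c with
  | zero => intro _ k hk; simpa using hk
  | succ c ih =>
    intro hc k hk
    refine ih (by omega) k ?_
    rw [add_mul, one_mul, ← add_assoc, h.step c (by omega)] at hk
    exact neg_eq_zero.1 hk

theorem IsShifted.eq_zero {U : ℕ → ℕ → K} {N p : ℕ} (h : IsShifted U N p)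
    (h₀ : ∀ k, U 0 k = 0) : ∀ i ≤ N, ∀ k, U i k = 0 := by
  intro i
  induction i with
  | zero => intro _; exact h₀
  | succ i ih =>
    intro hi k
    by_cases hk : k < p
    · exact h.low i (by omega) k hk
    · obtain ⟨k, rfl⟩ := Nat.exists_eq_add_of_le' (not_lt.1 hk)
      rw [h.step i (by omega), ih (by omega), neg_zero]

/-- The coordinates of a sequence of vectors, extended by zero. -/
def extendSeq (g : J ≃ Fin m) {N : ℕ} (u : Fin (N + 1) → J → K) (i k : ℕ) : K :=
  if h : i < N + 1 then extendZero g (u ⟨i, h⟩) k else 0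

/-- For this pair `X` shifts coordinates by `p` and `A` does not move them, so `u i X + u (i+1) A =
0` says that `u (i+1)` is minus the shift of `u i`. -/
theorem isShifted_of_prolongation_eq_zero {p : ℕ} (g : J ≃ Fin m) (h : I ≃ Fin (m + p)) (N : ℕ)
    (u : Fin (N + 1) → J → K)
    (hu : prolongation K I J N (shiftMatrix K g h p, shiftMatrix K g h 0) u = 0) :
    IsShifted (extendSeq g u) N p := by
  have key : ∀ i (hi : i < N) k (hk : k < m + p),
      (if p ≤ k then extendSeq g u i (k - p) else 0) + extendSeq g u (i + 1) k = 0 := by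
    intro i hi k hk
    have := congrFun (congrFun hu ⟨i, hi⟩) (h.symm ⟨k, hk⟩)
    rw [prolongation_apply, Pi.add_apply, vecMul_shiftMatrix, vecMul_shiftMatrix] at this
    simp only [Equiv.apply_symm_apply, zero_le, if_true, Nat.sub_zero] at this
    rw [extendSeq, extendSeq, dif_pos (by omega), dif_pos (by omega)]
    exact this
  constructor
  · intro i hi k hk
    have := key i hi k (by omega)
    rwa [if_neg (by omega), zero_add] at this
  · intro i hi k
    by_cases hk : k < m
    · have := key i hi (k + p) (by omega)
      rw [if_pos (by omega), Nat.add_sub_cancel] at this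
      exact eq_neg_of_add_eq_zero_right this
    · rw [extendSeq, extendSeq, dif_pos (by omega), dif_pos (by omega),
        extendZero_of_le _ _ (by omega), extendZero_of_le _ _ (by omega), neg_zero]

theorem eq_zero_of_extendSeq (g : J ≃ Fin m) {N : ℕ} (u : Fin (N + 1) → J → K)
    (h : ∀ i ≤ N, ∀ k, extendSeq g u i k = 0) : u = 0 := by
  funext i j
  have := h i (by omega) (g j)
  rw [extendSeq, dif_pos i.2, extendZero, dif_pos (g j).2] at this
  simpa using this

theorem injective_prolongation_shift {p q r : ℕ} (hm : m = q * p + r) (hr : r < p)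
    (g : J ≃ Fin m) (h : I ≃ Fin (m + p)) :
    Function.Injective
      (prolongation K I J (q + 1) (shiftMatrix K g h p, shiftMatrix K g h 0)) := by
  rw [injective_iff_map_eq_zero]
  intro u hu
  have hs := isShifted_of_prolongation_eq_zero g h _ u hu
  refine eq_zero_of_extendSeq g u (hs.eq_zero fun k => hs.zero_of_top (q + 1) le_rfl k ?_)
  -- After `q + 1` steps the displacement `(q + 1) p` exceeds `m = q p + r`.
  rw [extendSeq, dif_pos (by omega), extendZero_of_le]
  rw [hm, add_mul]
  omega

/-- In `q` steps all coordinates of `u 0` except the first `r` are pushed out. Adding those `r`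
coordinates as functionals (`π`) gives an injective map between spaces of equal dimension, `(q + 1)
m = q (m + p) + r`, hence a surjective one. -/
theorem surjective_prolongation_shift {p q r : ℕ} (hm : m = q * p + r)
    (g : J ≃ Fin m) (h : I ≃ Fin (m + p)) :
    Function.Surjective (prolongation K I J q (shiftMatrix K g h p, shiftMatrix K g h 0)) := by
  let T := prolongation K I J q (shiftMatrix K g h p, shiftMatrix K g h 0)
  let π : (Fin (q + 1) → J → K) →ₗ[K] (Fin r → K) :=
    { toFun := fun u c => u 0 (g.symm ⟨c, by omega⟩)
      map_add' := fun _ _ => rfl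
      map_smul' := fun _ _ => rfl }
  have hinj : Function.Injective (T.prod π) := by
    rw [injective_iff_map_eq_zero]
    intro u hu
    have hu₁ : T u = 0 := congrArg Prod.fst hu
    have hu₂ : π u = 0 := congrArg Prod.snd hu
    have hs := isShifted_of_prolongation_eq_zero g h _ u hu₁
    refine eq_zero_of_extendSeq g u (hs.eq_zero fun k => ?_)
    by_cases hk : k < r
    · rw [extendSeq, dif_pos (by omega), extendZero, dif_pos (by omega)]
      exact congrFun hu₂ ⟨k, hk⟩
    · refine hs.zero_of_top q le_rfl k ?_
      rw [extendSeq, dif_pos (by omega), extendZero_of_le]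
      omega
  have hdim : finrank K (Fin (q + 1) → J → K) = finrank K ((Fin q → I → K) × (Fin r → K)) := by
    have hJ : Fintype.card J = m := by simpa using Fintype.card_congr g
    have hI : Fintype.card I = m + p := by simpa using Fintype.card_congr h
    simp only [finrank_prod, finrank_pi_fintype, finrank_self, Finset.sum_const, Finset.card_univ,
      Fintype.card_fin, hJ, hI, smul_eq_mul, mul_one]
    rw [hm]
    ring
  have hsurj := (LinearMap.injective_iff_surjective_of_finrank_eq_finrank hdim).1 hinj
  intro v
  obtain ⟨u, hu⟩ := hsurj (v, 0)
  exact ⟨u, congrArg Prod.fst hu⟩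

end ShiftPair

theorem exists_inverse_of_basis {I' : Type} [Fintype I'] [DecidableEq I] [DecidableEq I']
    (f : Basis I' K (I → K)) : ∃ P' : Matrix I I' K,
      Matrix.of (fun y => f y) * P' = 1 ∧ P' * Matrix.of (fun y => f y) = 1 := by
  have h₁ := f.toMatrix_mul_toMatrix_flip (Pi.basisFun K I)
  have h₂ := (Pi.basisFun K I).toMatrix_mul_toMatrix_flip f
  have h₃ : ((Pi.basisFun K I).toMatrix f).transpose = Matrix.of (fun y => f y) := by
    ext i j
    simp [Basis.toMatrix_apply]
  refine ⟨(f.toMatrix (Pi.basisFun K I)).transpose, ?_, ?_⟩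
  · rw [← h₃, ← Matrix.transpose_mul, h₁, Matrix.transpose_one]
  · rw [← h₃, ← Matrix.transpose_mul, h₂, Matrix.transpose_one]

/-- A generic pair of wide matrices is a sum of chains of almost equal lengths. -/
theorem holdsGenerically_hasBlocks_wide [CharZero K] (ε : ℤˣ) {m p q r : ℕ}
    (hJ : Fintype.card J = m) (hI : Fintype.card I = m + p) (hm : m = q * p + r) (hr : r < p) :
    HoldsGenerically K fun X A : Matrix J I K =>
      ∃ (ι : Type) (_ : Fintype ι) (_ : LinearOrder ι) (d : ι → ℕ),
        (∀ i, d i = q ∨ d i = q + 1) ∧ ∑ i, d i = m ∧ Fintype.card ι = p ∧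
        HasBlocks (leftPencil ε X) (leftPencil ε A)
          (Finset.univ.val.map (fun P : IndexPair ε ι => Block.horizontal (pairWidth ε d P)) +
            Multiset.replicate (finrank K (hookForms ε d K)) (Block.vertical 1)) := by
  classical
  let g : J ≃ Fin m := Fintype.equivFinOfCardEq hJ
  let h : I ≃ Fin (m + p) := Fintype.equivFinOfCardEq hI
  refine ((holdsGenerically_injective (prolongation K I J (q + 1)) _ _
    (injective_prolongation_shift hm hr g h)).and
      (holdsGenerically_surjective (prolongation K I J q) _ _
        (surjective_prolongation_shift hm g h))).mono fun X A hXA => ?_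
  obtain ⟨ι, _, d, e, f, hd, hAe, hXe⟩ := exists_chain_bases q
    (Matrix.vecMulLinear X) (Matrix.vecMulLinear A) (by
      intro v
      obtain ⟨u, hu⟩ := hXA.2 fun i => v i
      refine ⟨fun i => if hi : i < q + 1 then u ⟨i, hi⟩ else 0, fun i hi => ?_⟩
      simp only [dif_pos (show i < q + 1 by omega), dif_pos (show i + 1 < q + 1 by omega)]
      exact congrFun hu ⟨i, hi⟩) (by
      intro u hu i hi
      have := (injective_iff_map_eq_zero _).1 hXA.1 (fun i => u i) (funext fun i => by
        exact hu i (by omega))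
      exact congrFun this ⟨i, by omega⟩)
  let L : LinearOrder ι := LinearOrder.lift' (Fintype.equivFin ι) (Fintype.equivFin ι).injective
  have c₁ : ∑ i, d i = m := by
    have := finrank_eq_card_basis e
    rw [finrank_fintype_fun_eq_card, hJ] at this
    simpa using this.symm
  have c₂ : Fintype.card ι = p := by
    have := finrank_eq_card_basis f
    rw [finrank_fintype_fun_eq_card, hI] at this
    simp [Finset.sum_add_distrib] at this
    omega
  refine ⟨ι, _, L, d, hd, c₁, c₂, ?_⟩
  obtain ⟨P', hP, hP'⟩ := exists_inverse_of_basis f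
  obtain ⟨Q', hQ, hQ'⟩ := exists_inverse_of_basis e
  -- The matrices whose rows are the chain bases `f` and `e` carry the pair to `succMatrix`,
  -- `castMatrix`.
  refine hasBlocks_leftPencil_chains.leftPencil_of_equiv _ P' hP hP' _ Q' hQ hQ' ?_ ?_
  · ext ⟨i, a⟩ y
    have := congrFun (hXe i a) y
    simpa [Matrix.mul_apply, succMatrix, Matrix.vecMul, dotProduct] using this
  · ext ⟨i, a⟩ y
    have := congrFun (hAe i a) y
    simpa [Matrix.mul_apply, castMatrix, Matrix.vecMul, dotProduct] using this

/-- On the two values `q`, `q + 1` any `φ` agrees with an affine function, so only the number of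
chains and their total length matter. -/
theorem sum_comp_eq_of_almost_equal {ι : Type} [Fintype ι] {d : ι → ℕ} {q p r : ℕ}
    (hd : ∀ i, d i = q ∨ d i = q + 1) (hs : ∑ i, d i = q * p + r) (hp : Fintype.card ι = p)
    (φ : ℕ → ℤ) : ∑ i, φ (d i) = (p - r) * φ q + r * φ (q + 1) := by
  have h₁ : ∀ i, φ (d i) = φ q + ((d i : ℤ) - q) * (φ (q + 1) - φ q) := by
    intro i
    obtain h | h := hd i <;> rw [h] <;> push_cast <;> ring
  have h₂ : ((∑ i, d i : ℕ) : ℤ) = q * p + r := by rw [hs]; push_cast; ring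
  push_cast at h₂
  simp only [h₁, Finset.sum_add_distrib, ← Finset.sum_mul, Finset.sum_sub_distrib,
    Finset.sum_const, Finset.card_univ, hp, h₂, nsmul_eq_mul]
  ring

theorem horizontal_indices_eq {ι : Type} [Fintype ι] [LinearOrder ι] (ε : ℤˣ) {d : ι → ℕ}
    {q p r N₁ N₂ N₃ : ℕ} (hd : ∀ i, d i = q ∨ d i = q + 1) (hs : ∑ i, d i = q * p + r)
    (hp : Fintype.card ι = p) (h₁ : 2 * (N₁ : ℤ) = (p - r) * (p - r) + ε * (p - r))
    (h₂ : (N₂ : ℤ) = (p - r) * r) (h₃ : 2 * (N₃ : ℤ) = r * r + ε * r) :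
    Finset.univ.val.map (fun P : IndexPair ε ι => pairWidth ε d P + 1) =
      Multiset.replicate N₁ (2 * q + 1) + Multiset.replicate N₂ (2 * q + 2) +
        Multiset.replicate N₃ (2 * q + 3) := by
  ext v
  -- The multiplicity of `v` is the sum of this indicator over independent pairs; doubling turns it
  -- into sums over all ordered pairs and over the diagonal.
  let ψ : ℕ → ℤ := fun c => if v = c + 1 then 1 else 0
  have e₁ := two_mul_sum_indexPair ε (fun i j => ψ (d i + d j)) fun i j => by rw [add_comm]
  have e₂ : ∑ i, ∑ j, ψ (d i + d j) = (p - r) * ((p - r) * ψ (q + q) + r * ψ (q + (q + 1))) +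
      r * ((p - r) * ψ (q + 1 + q) + r * ψ (q + 1 + (q + 1))) := by
    have : ∀ i, ∑ j, ψ (d i + d j) = (p - r) * ψ (d i + q) + r * ψ (d i + (q + 1)) := fun i =>
      sum_comp_eq_of_almost_equal hd hs hp fun c => ψ (d i + c)
    simp only [this]
    exact sum_comp_eq_of_almost_equal hd hs hp fun c => (p - r) * ψ (c + q) + r * ψ (c + (q + 1))
  have e₃ : ∑ i, ψ (d i + d i) = (p - r) * ψ (q + q) + r * ψ (q + 1 + (q + 1)) :=
    sum_comp_eq_of_almost_equal hd hs hp fun c => ψ (c + c)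
  have e₄ : (Multiset.count v
      (Finset.univ.val.map (fun P : IndexPair ε ι => pairWidth ε d P + 1)) : ℤ) =
      ∑ P : IndexPair ε ι, ψ (d P.1.1 + d P.1.2) := by
    rw [Multiset.count_map]
    simp only [ψ, Finset.sum_boole, pairWidth]
    rfl
  rw [e₂, e₃] at e₁
  zify
  rw [e₄]
  simp only [Multiset.count_add, Multiset.count_replicate, Nat.cast_add, Nat.cast_ite,
    Nat.cast_zero]
  have w₁ : ψ (q + q) = if 2 * q + 1 = v then 1 else 0 := by simp only [ψ]; congr 1; grind
  have w₂ : ψ (q + (q + 1)) = if 2 * q + 2 = v then 1 else 0 := by simp only [ψ]; congr 1; grind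
  have w₂' : ψ (q + 1 + q) = if 2 * q + 2 = v then 1 else 0 := by simp only [ψ]; congr 1; grind
  have w₃ : ψ (q + 1 + (q + 1)) = if 2 * q + 3 = v then 1 else 0 := by
    simp only [ψ]; congr 1; grind
  rw [w₁, w₂, w₂', w₃] at e₁
  have z₁ : (if 2 * q + 1 = v then (N₁ : ℤ) else 0) = N₁ * if 2 * q + 1 = v then 1 else 0 := by simp
  have z₂ : (if 2 * q + 2 = v then (N₂ : ℤ) else 0) = N₂ * if 2 * q + 2 = v then 1 else 0 := by simp
  have z₃ : (if 2 * q + 3 = v then (N₃ : ℤ) else 0) = N₃ * if 2 * q + 3 = v then 1 else 0 := by simp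
  rw [z₁, z₂, z₃]
  generalize (if 2 * q + 1 = v then (1 : ℤ) else 0) = x₁ at *
  generalize (if 2 * q + 2 = v then (1 : ℤ) else 0) = x₂ at *
  generalize (if 2 * q + 3 = v then (1 : ℤ) else 0) = x₃ at *
  refine mul_left_cancel₀ (two_ne_zero (α := ℤ)) ?_
  linear_combination e₁ - x₁ * h₁ - 2 * x₂ * h₂ - x₃ * h₃

/-- The type of the pencil of forms for a generic pair of wide matrices. -/
theorem holdsGenerically_type_wide [CharZero K] (ε : ℤˣ) {m p q r N₁ N₂ N₃ N : ℕ}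
    (hJ : Fintype.card J = m) (hI : Fintype.card I = m + p) (hm : m = q * p + r) (hr : r < p)
    (h₁ : 2 * (N₁ : ℤ) = (p - r) * (p - r) + ε * (p - r))
    (h₂ : (N₂ : ℤ) = (p - r) * r) (h₃ : 2 * (N₃ : ℤ) = r * r + ε * r)
    (hN : 2 * (N : ℤ) = m * m - ε * m) :
    HoldsGenerically K fun X A : Matrix J I K => ∃ s,
      HasBlocks (leftPencil ε X) (leftPencil ε A) s ∧ typeOfBlocks s =
        { jordan := 0
          horizontal := Multiset.replicate N₁ (2 * q + 1) + Multiset.replicate N₂ (2 * q + 2) +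
            Multiset.replicate N₃ (2 * q + 3)
          vertical := Multiset.replicate N 2 } := by
  refine (holdsGenerically_hasBlocks_wide ε hJ hI hm hr).mono fun X A h => ?_
  obtain ⟨ι, _, _, d, hd, hs, hp, h⟩ := h
  refine ⟨_, h, ?_⟩
  have := typeOfBlocks_horizontal_vertical (K := K) (pairWidth ε d)
    (finrank K (hookForms ε d K)) 0
  rw [Multiset.replicate_zero, Multiset.replicate_zero, add_zero, add_zero] at this
  rw [this, horizontal_indices_eq ε hd (hs.trans hm) hp h₁ h₂ h₃]
  have hu := (finrank_hookForms (K := K) (ε := ε) (d := d)).1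
  rw [hs, ← hN] at hu
  rw [show finrank K (hookForms ε d K) = N by omega]

end Wide

/-! ### Generic tall matrices: `m > n`, and `m = n` in the skew case -/

section Tall

open Module

variable {K : Type*} [Field K]

/-- The target splits into the independent images of `B` and `A` and a complement met by neither,
which contributes the zero rows. -/
theorem hasBlocks_of_injective {U V : Type*} [AddCommGroup U] [Module K U] [FiniteDimensional K U]
    [AddCommGroup V] [Module K V] [FiniteDimensional K V] (A B : U →ₗ[K] V)
    (h : Function.Injective (B.coprod A)) {N' : ℕ} (hN' : N' + 2 * finrank K U = finrank K V) :
    HasBlocks A B (Multiset.replicate (finrank K U) (Block.vertical 1) +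
      Multiset.replicate N' (Block.vertical 0)) := by
  obtain ⟨C, hC⟩ := Submodule.exists_isCompl (LinearMap.range (B.coprod A))
  have hdim : finrank K C = N' := by
    have h₁ := Submodule.finrank_add_eq_of_isCompl hC
    rw [LinearMap.finrank_range_of_inj h, finrank_prod] at h₁
    omega
  rw [← hdim]
  let e : (U × (Fin 0 → K)) ≃ₗ[K] U := LinearEquiv.prodUnique
  let f : ((U × U) × C) ≃ₗ[K] V :=
    (LinearEquiv.prodCongr (LinearEquiv.ofInjective _ h) (LinearEquiv.refl K C)).trans
      (Submodule.prodEquivOfIsCompl _ C hC)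
  have hf : ∀ u v, f ((u, v), 0) = B u + A v := fun u v => by simp [f]
  refine (hasBlocks_inr_inl.prod (hasBlocks_zero (U := Fin 0 → K) (V := C) 0 0)).of_equiv e f ?_ ?_
  · rintro ⟨u, z⟩
    refine Eq.trans ?_ (hf 0 u).symm
    simp [e]
  · rintro ⟨u, z⟩
    refine Eq.trans ?_ (hf u 0).symm
    simp [e]

variable {I J : Type} [Fintype I] [Fintype J]

/-- The pairs of forms `(S, T) ↦ A S + X T`, as a family that depends linearly on `(X, A)`. -/
def pairPencil (K : Type*) [Field K] (I J : Type) [Fintype I] (ε : ℤˣ) :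
    Matrix J I K × Matrix J I K →ₗ[K] (epsSym K ε I × epsSym K ε I) →ₗ[K] Matrix J I K :=
  LinearMap.mk₂ K (fun Y S => Y.2 * S.1.1 + Y.1 * S.2.1)
    (fun Y Z S => by simp [Matrix.add_mul]; abel)
    (fun c Y S => by simp)
    (fun Y S T => by simp [Matrix.mul_add]; abel)
    (fun c Y S => by simp)

/-- The matrix with a diagonal block and with all entries `1` in the remaining rows. -/
noncomputable def paddedDiagonal [DecidableEq J] (φ : I ↪ J) (D : I → K) : Matrix J I K :=
  open Classical in
  Matrix.of fun j i => if j = φ i then D i else if j ∈ Set.range φ then 0 else 1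

/-- The rows in the range of `φ` give `S i y + D i * T i y = 0`; by symmetry the same holds with `D
y`, so `T` is diagonal. Its diagonal dies by skewness, or because an extra row of ones reads off the
column sums of `T`. -/
theorem injective_pairPencil_paddedDiagonal [CharZero K] [DecidableEq J] (ε : ℤˣ) (φ : I ↪ J)
    (D : I → K) (hD : Function.Injective D) (h : ε = -1 ∨ ∃ j, j ∉ Set.range φ) :
    Function.Injective (pairPencil K I J ε
      (paddedDiagonal φ D, Matrix.of fun j i => if j = φ i then 1 else 0)) := by
  classical
  rw [injective_iff_map_eq_zero]
  rintro ⟨S, T⟩ hST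
  have h₀ : ∀ j y, (Matrix.of (fun j i => if j = φ i then (1 : K) else 0) * S.1) j y +
      (paddedDiagonal φ D * T.1) j y = 0 := fun j y => congrFun (congrFun hST j) y
  have h₁ : ∀ i y, S.1 i y + D i * T.1 i y = 0 := by
    intro i y
    have := h₀ (φ i) y
    rw [Matrix.mul_apply, Matrix.mul_apply] at this
    simpa [paddedDiagonal, ite_and] using this
  have h₂ : ∀ i y, i ≠ y → T.1 i y = 0 := by
    intro i y hiy
    have e₁ := h₁ i y
    have e₂ := h₁ y i
    rw [S.2 i y, T.2 i y, mul_left_comm, ← mul_add] at e₂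
    have e₃ : S.1 i y + D y * T.1 i y = 0 := by
      rw [← units_mul_self ε (_ + _), e₂, mul_zero]
    have e₄ : (D i - D y) * T.1 i y = 0 := by linear_combination e₁ - e₃
    exact (mul_eq_zero.1 e₄).resolve_left (sub_ne_zero.2 fun h => hiy (hD h))
  have h₃ : ∀ y, T.1 y y = 0 := by
    intro y
    obtain rfl | ⟨j, hj⟩ := h
    · exact self_eq_neg.1 (by simpa using T.2 y y)
    · have := h₀ j y
      rw [Matrix.mul_apply, Matrix.mul_apply] at this
      have hne : ∀ i, j ≠ φ i := fun i hi => hj ⟨i, hi.symm⟩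
      rw [Finset.sum_eq_zero fun i _ => by simp [hne], zero_add,
        Finset.sum_eq_single y (fun i _ hi => by rw [h₂ i y hi, mul_zero]) (by simp)] at this
      have hj' : ¬ ∃ i, φ i = j := hj
      simpa [paddedDiagonal, hne, hj'] using this
  have hT : T = 0 := by
    ext i y
    by_cases hiy : i = y
    · subst hiy; exact h₃ i
    · exact h₂ i y hiy
  subst hT
  have hS : S = 0 := by
    ext i y
    simpa using h₁ i y
  rw [hS]
  rfl

/-- The type of the pencil of forms for a generic pair of tall matrices. -/
theorem holdsGenerically_type_tall [CharZero K] (ε : ℤˣ) {N N' : ℕ}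
    (hIJ : Fintype.card I ≤ Fintype.card J) (h : ε = -1 ∨ Fintype.card I < Fintype.card J)
    (hN : 2 * (N : ℤ) = Fintype.card I * Fintype.card I + ε * Fintype.card I)
    (hN' : N' + 2 * N = Fintype.card J * Fintype.card I) :
    HoldsGenerically K fun X A : Matrix J I K => ∃ s,
      HasBlocks (leftPencil ε X) (leftPencil ε A) s ∧ typeOfBlocks s =
        { jordan := 0
          horizontal := 0
          vertical := Multiset.replicate N 2 + Multiset.replicate N' 1 } := by
  classical
  obtain ⟨φ⟩ := Function.Embedding.nonempty_of_card_le hIJ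
  have hφ : ε = -1 ∨ ∃ j, j ∉ Set.range φ := by
    refine h.imp id fun hlt => ?_
    by_contra! hall
    exact hlt.not_ge (Fintype.card_le_of_surjective φ hall)
  let D : I → K := fun i => ((Fintype.equivFin I i : ℕ) : K)
  have hD : Function.Injective D := fun i j hij =>
    (Fintype.equivFin I).injective (Fin.ext (Nat.cast_injective hij))
  refine (holdsGenerically_injective (pairPencil K I J ε) _ _
    (injective_pairPencil_paddedDiagonal ε φ D hD hφ)).mono fun X A hXA => ?_
  have hU : finrank K (epsSym K ε I) = N := by
    have := two_mul_finrank_epsSym (K := K) (I := I) ε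
    omega
  have hV : finrank K (Matrix J I K) = Fintype.card J * Fintype.card I := by
    rw [finrank_matrix, finrank_self, mul_one]
  refine ⟨_, hasBlocks_of_injective (N' := N') (leftPencil ε X) (leftPencil ε A) ?_ ?_, ?_⟩
  -- By definition `pairPencil` at `(X, A)` is the coproduct of the two maps of the pencil.
  · exact hXA
  · rw [hU, hV, hN']
  · rw [hU]
    simpa using typeOfBlocks_horizontal_vertical (K := K) (ι := Fin 0) (fun _ => 0) N N'

end Tall

/-! ### Generic square matrices in the symmetric case -/

section Square

open Module Polynomial

variable {K : Type*} [Field K] {J : Type} [Fintype J] [DecidableEq J]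

/-- Symmetric matrices with zero diagonal. -/
def hollowForms (K : Type*) [Field K] (J : Type) : Submodule K (Matrix J J K) where
  carrier := {S | S ∈ epsSym K 1 J ∧ ∀ i, S i i = 0}
  add_mem' hS hT := ⟨add_mem hS.1 hT.1, fun i => by simp [hS.2 i, hT.2 i]⟩
  zero_mem' := ⟨zero_mem _, fun i => rfl⟩
  smul_mem' c S hS := ⟨Submodule.smul_mem _ c hS.1, fun i => by simp [hS.2 i]⟩

/-- The symmetric matrix with given diagonal and off-diagonal parts. -/
def diagonalAddHollow (K : Type*) [Field K] (J : Type) [DecidableEq J] :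
    ((J → K) × hollowForms K J) →ₗ[K] epsSym K 1 J where
  toFun fs := ⟨Matrix.diagonal fs.1 + fs.2.1, add_mem (mem_epsSym_iff_transpose.2 (by simp)) fs.2.2.1⟩
  map_add' fs gt := by
    ext1
    have h : Matrix.diagonal (fs.1 + gt.1) = Matrix.diagonal fs.1 + Matrix.diagonal gt.1 :=
      (Matrix.diagonal_add _ _).symm
    simp only [Prod.fst_add, Prod.snd_add, Submodule.coe_add, h]
    abel
  map_smul' c fs := by
    ext1
    simp [Matrix.diagonal_smul]

theorem bijective_diagonalAddHollow : Function.Bijective (diagonalAddHollow K J) := by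
  constructor
  · rw [injective_iff_map_eq_zero]
    rintro ⟨f, s⟩ h
    have h₀ : Matrix.diagonal f + s.1 = 0 := congrArg Subtype.val h
    have hf : f = 0 := by
      funext i
      have := congrFun (congrFun h₀ i) i
      simpa [s.2.2 i] using this
    subst hf
    rw [Prod.mk_eq_zero]
    exact ⟨rfl, Subtype.ext (by simpa using h₀)⟩
  · intro S
    refine ⟨(fun i => S.1 i i, ⟨S.1 - Matrix.diagonal fun i => S.1 i i, sub_mem S.2
      (mem_epsSym_iff_transpose.2 (by simp)), fun i => by simp⟩), Subtype.ext ?_⟩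
    simp [diagonalAddHollow]

/-- The diagonal part and the two off-diagonal parts of the range of a diagonal pencil. -/
def hollowRange (μ : J → K) :
    ((J → K) × (hollowForms K J × hollowForms K J)) →ₗ[K] Matrix J J K where
  toFun x := Matrix.diagonal x.1 + (x.2.1.1 + Matrix.diagonal μ * x.2.2.1)
  map_add' x y := by
    have h : Matrix.diagonal (x.1 + y.1) = Matrix.diagonal x.1 + Matrix.diagonal y.1 :=
      (Matrix.diagonal_add _ _).symm
    simp only [Prod.fst_add, Prod.snd_add, Submodule.coe_add, h, Matrix.mul_add]
    abel
  map_smul' c x := by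
    simp [Matrix.diagonal_smul]

/-- The diagonal entries give `f = 0`. Off the diagonal, symmetry yields both `s + μ i t = 0` and `s
+ μ j t = 0`, with `μ i ≠ μ j`. -/
theorem injective_hollowRange (μ : J → K) (hμ : Function.Injective μ) :
    Function.Injective (hollowRange μ) := by
  rw [injective_iff_map_eq_zero]
  rintro ⟨f, s, t⟩ h
  have h₀ : ∀ i j, Matrix.diagonal f i j + (s.1 i j + μ i * t.1 i j) = 0 := fun i j => by
    have : Matrix.diagonal f i j + (s.1 i j + (Matrix.diagonal μ * t.1) i j) = 0 :=
      congrFun (congrFun h i) j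
    rwa [Matrix.diagonal_mul] at this
  have hf : f = 0 := by
    funext i
    simpa [s.2.2 i, t.2.2 i] using h₀ i i
  subst hf
  simp only [Matrix.diagonal_zero, Matrix.zero_apply, zero_add, Pi.zero_def] at h₀
  have ht : t = 0 := by
    ext i j
    by_cases hij : i = j
    · subst hij; exact t.2.2 i
    · have e₁ := h₀ i j
      have e₂ := h₀ j i
      rw [s.2.1 i j, t.2.1 i j] at e₂
      have e₃ : (μ i - μ j) * t.1 i j = 0 := by
        simp only [Units.val_one, Int.cast_one, one_mul] at e₂
        linear_combination e₁ - e₂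
      exact (mul_eq_zero.1 e₃).resolve_left (sub_ne_zero.2 fun h => hij (hμ h))
  subst ht
  have hs : s = 0 := by
    ext i j
    simpa using h₀ i j
  subst hs
  rfl

theorem hasBlocks_diagonal_pencil [CharZero K] (μ : J → K) (hμ : Function.Injective μ) {N : ℕ}
    (hN : 2 * (N : ℤ) = Fintype.card J * Fintype.card J - Fintype.card J) :
    HasBlocks (leftPencil 1 (Matrix.diagonal μ)) (leftPencil 1 (1 : Matrix J J K))
      (Finset.univ.val.map (fun i => Block.jordan (μ i : OnePoint K) 0) +
        Multiset.replicate N (Block.vertical 1)) := by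
  have hU : finrank K (hollowForms K J) = N := by
    have h₁ := (LinearEquiv.ofBijective _ (bijective_diagonalAddHollow (K := K) (J := J))).finrank_eq
    have h₂ := two_mul_finrank_epsSym (K := K) (I := J) 1
    rw [← h₁, finrank_prod, finrank_fintype_fun_eq_card] at h₂
    push_cast at h₂
    zify
    linarith
  rw [← hU]
  refine ((hasBlocks_diagonal μ).prod hasBlocks_inr_inl).of_equiv
    (LinearEquiv.ofBijective _ bijective_diagonalAddHollow)
    (LinearEquiv.ofInjectiveOfFinrankEq (hollowRange μ) (injective_hollowRange μ hμ) ?_) ?_ ?_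
  · rw [finrank_matrix, finrank_prod, finrank_prod, finrank_self, mul_one, hU,
      finrank_fintype_fun_eq_card]
    zify
    linarith
  · rintro ⟨f, s⟩
    change Matrix.diagonal μ * (Matrix.diagonal f + s.1) =
      Matrix.diagonal (fun i => μ i • f i) + (0 + Matrix.diagonal μ * s.1)
    rw [Matrix.mul_add, Matrix.diagonal_mul_diagonal, zero_add]
    rfl
  · rintro ⟨f, s⟩
    change 1 * (Matrix.diagonal f + s.1) = Matrix.diagonal f + (s.1 + Matrix.diagonal μ * 0)
    simp

/-- A matrix that is not annihilated in part by the derivative of its characteristic polynomial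
has pairwise distinct eigenvalues. -/
theorem exists_diagonalization [IsAlgClosed K] (Y : Matrix J J K)
    (h : (aeval Y (derivative Y.charpoly)).det ≠ 0) :
    ∃ (μ : J → K) (E E' : Matrix J J K), Function.Injective μ ∧ E * E' = 1 ∧ E' * E = 1 ∧
      E * Y.transpose = Matrix.diagonal μ * E := by
  classical
  have hne : Y.charpoly ≠ 0 := Y.charpoly_monic.ne_zero
  have hev : ∀ μ, Y.charpoly.IsRoot μ → ∃ v, Module.End.HasEigenvector (Matrix.toLin' Y) μ v := by
    intro μ hμ
    refine Module.End.HasEigenvalue.exists_hasEigenvector ?_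
    rwa [Module.End.hasEigenvalue_iff_isRoot_charpoly, Matrix.charpoly_toLin']
  have hnodup : Y.charpoly.roots.Nodup := by
    rw [Multiset.nodup_iff_count_le_one]
    intro μ
    rw [count_roots]
    by_contra! hlt
    -- A multiple root is also a root of the derivative, so its eigenvector would be killed by the
    -- derivative evaluated at `Y`, which is invertible.
    have hr := (one_lt_rootMultiplicity_iff_isRoot hne).1 hlt
    obtain ⟨v, hv⟩ := hev μ hr.1
    have h₁ := Module.End.aeval_apply_of_hasEigenvector (p := derivative Y.charpoly) hv
    rw [hr.2.eq_zero, zero_smul] at h₁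
    have h₂ : aeval (Matrix.toLin' Y) (derivative Y.charpoly) =
        Matrix.toLin' (aeval Y (derivative Y.charpoly)) :=
      aeval_algHom_apply (Matrix.toLinAlgEquiv' : Matrix J J K ≃ₐ[K] _).toAlgHom Y _
    rw [h₂, Matrix.toLin'_apply] at h₁
    exact h (Matrix.exists_mulVec_eq_zero_iff.1 ⟨v, hv.2, h₁⟩)
  have hcard : Y.charpoly.roots.toFinset.card = Fintype.card J := by
    rw [Multiset.toFinset_card_of_nodup hnodup,
      ← (IsAlgClosed.splits Y.charpoly).natDegree_eq_card_roots, Matrix.charpoly_natDegree_eq_dim]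
  let σ : J ≃ Y.charpoly.roots.toFinset := Fintype.equivOfCardEq (by simpa using hcard.symm)
  let μ : J → K := fun j => (σ j : K)
  have hμ : Function.Injective μ := fun i j h => σ.injective (Subtype.ext h)
  have hroot : ∀ j, Y.charpoly.IsRoot (μ j) := fun j =>
    isRoot_of_mem_roots (Multiset.mem_toFinset.1 (σ j).2)
  choose v hv using fun j => hev (μ j) (hroot j)
  have hli : LinearIndependent K v := by
    refine Module.End.eigenvectors_linearIndependent' (Matrix.toLin' Y) μ hμ v hv
  let f := basisOfLinearIndependentOfCardEqFinrank' v hli (by simp)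
  obtain ⟨E', hE, hE'⟩ := exists_inverse_of_basis f
  refine ⟨μ, _, E', hμ, hE, hE', ?_⟩
  ext j i
  have := congrFun (hv j).apply_eq_smul i
  rw [Matrix.diagonal_mul, Matrix.mul_apply]
  simpa [f, Matrix.mulVec, dotProduct, mul_comm] using this

/-- The adjugate replaces the inverse to keep the entries polynomial; this only rescales the
eigenvalues by `det A`. The required polynomial is the same expression formed from matrices over the
polynomial ring. -/
theorem holdsGenerically_exists_diagonalization [CharZero K] [IsAlgClosed K] {I : Type} [Fintype I]
    (σ : I ≃ J) :
    HoldsGenerically K fun X A : Matrix J I K =>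
      (A.submatrix id σ.symm).det ≠ 0 ∧ (aeval
        ((X.submatrix id σ.symm * (A.submatrix id σ.symm).adjugate).transpose)
        (derivative (X.submatrix id σ.symm *
          (A.submatrix id σ.symm).adjugate).transpose.charpoly)).det ≠ 0 := by
  have entry : ∀ (l : Matrix J I K × Matrix J I K →ₗ[K] Matrix J I K) j j',
      ∃ p : MvPolynomial (Fin (finrank K (Matrix J I K)) ⊕ Fin (finrank K (Matrix J I K))) K,
        ∀ X A : Matrix J I K, evalPair X A p = l (X, A) j (σ.symm j') := fun l j j' =>
    exists_evalPair_eq (LinearMap.proj (σ.symm j') ∘ₗ LinearMap.proj j ∘ₗ l)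
  choose pX hX using entry (LinearMap.fst K _ _)
  choose pA hA using entry (LinearMap.snd K _ _)
  let Yp := (Matrix.of pX * (Matrix.of pA).adjugate).transpose
  let p := (Matrix.of pA).det * (aeval Yp (derivative Yp.charpoly)).det
  have hp : ∀ X A : Matrix J I K, evalPair X A p = (A.submatrix id σ.symm).det * (aeval
        ((X.submatrix id σ.symm * (A.submatrix id σ.symm).adjugate).transpose)
        (derivative (X.submatrix id σ.symm *
          (A.submatrix id σ.symm).adjugate).transpose.charpoly)).det := by
    intro X A
    have hXm : (evalPair X A).mapMatrix (Matrix.of pX) = X.submatrix id σ.symm := by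
      ext j j'
      exact hX j j' X A
    have hAm : (evalPair X A).mapMatrix (Matrix.of pA) = A.submatrix id σ.symm := by
      ext j j'
      exact hA j j' X A
    have hY : (evalPair X A).mapMatrix Yp =
        (X.submatrix id σ.symm * (A.submatrix id σ.symm).adjugate).transpose := by
      rw [← hXm, ← hAm, ← RingHom.map_adjugate, ← map_mul]
      rfl
    rw [map_mul, RingHom.map_det, RingHom.map_det, hAm, ← hY]
    congr 2
    rw [aeval_def, aeval_def, hom_eval₂, RingHom.mapMatrix_apply, Matrix.charpoly_map,
      derivative_map, eval₂_map]
    congr 1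
    refine RingHom.ext fun c => ?_
    ext i j
    simp only [RingHom.comp_apply, RingHom.mapMatrix_apply, Matrix.map_apply,
      Matrix.algebraMap_matrix_apply, Algebra.algebraMap_self, RingHom.id_apply]
    split_ifs <;> simp
  let D : J → K := fun i => ((Fintype.equivFin J i : ℕ) : K)
  have hD : Function.Injective D := fun i j hij =>
    (Fintype.equivFin J).injective (Fin.ext (Nat.cast_injective hij))
  refine HoldsGenerically.of_ne_zero p ((Matrix.diagonal D).submatrix id σ)
    ((1 : Matrix J J K).submatrix id σ) ?_ fun X A h => ?_
  · rw [hp]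
    simp only [Matrix.submatrix_submatrix, Function.comp_id, Equiv.self_comp_symm,
      Matrix.submatrix_id_id, Matrix.adjugate_one, mul_one, Matrix.det_one, one_mul,
      Matrix.diagonal_transpose]
    -- In a Bézout relation `a χ + b χ' = 1` the first term vanishes at the matrix by
    -- Cayley–Hamilton, so `χ'` becomes invertible there.
    have hsep : (Matrix.diagonal D).charpoly.Separable := by
      rw [Matrix.charpoly_diagonal]
      exact separable_prod_X_sub_C_iff.2 hD
    obtain ⟨a, b, hab⟩ := hsep
    have h₁ := congrArg (aeval (Matrix.diagonal D)) hab
    rw [map_add, map_mul, map_mul, Matrix.aeval_self_charpoly, mul_zero, zero_add, map_one] at h₁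
    have h₂ := congrArg Matrix.det h₁
    rw [Matrix.det_mul, Matrix.det_one] at h₂
    exact right_ne_zero_of_mul (h₂ ▸ one_ne_zero)
  · rw [hp] at h
    exact ⟨left_ne_zero_of_mul h, right_ne_zero_of_mul h⟩

/-- The type of the pencil of symmetric forms for a generic pair of square matrices. -/
theorem holdsGenerically_type_square [CharZero K] [IsAlgClosed K] {I J : Type} [Fintype I]
    [Fintype J] {n N : ℕ} (hI : Fintype.card I = n) (hJ : Fintype.card J = n)
    (hN : 2 * (N : ℤ) = n * n - n) :
    HoldsGenerically K fun X A : Matrix J I K => ∃ s,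
      HasBlocks (leftPencil 1 X) (leftPencil 1 A) s ∧ typeOfBlocks s =
        { jordan := Multiset.replicate n {1}
          horizontal := 0
          vertical := Multiset.replicate N 2 } := by
  classical
  let σ : I ≃ J := Fintype.equivOfCardEq (hI.trans hJ.symm)
  refine (holdsGenerically_exists_diagonalization σ).mono fun X A hXA => ?_
  obtain ⟨hdet, hY⟩ := hXA
  set X' := X.submatrix id σ.symm with hX'
  set A' := A.submatrix id σ.symm with hA'
  obtain ⟨μ, E, E', hμ, hE, hE', hEY⟩ := exists_diagonalization _ hY
  rw [Matrix.transpose_transpose] at hEY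
  -- Dividing by the determinant turns eigenvalues of `X' * adjugate A'` into those of `X' * A'⁻¹`.
  let ν : J → K := fun j => A'.det⁻¹ * μ j
  have hν : Function.Injective ν := fun i j h => hμ (mul_left_cancel₀ (inv_ne_zero hdet) h)
  have hEX : E * X' = Matrix.diagonal ν * (E * A') := by
    have h₁ := congrArg (· * A') hEY
    simp only [Matrix.mul_assoc, Matrix.adjugate_mul, Matrix.mul_smul, Matrix.mul_one] at h₁
    have h₂ : Matrix.diagonal ν = A'.det⁻¹ • Matrix.diagonal μ := by
      rw [← Matrix.diagonal_smul]
      rfl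
    rw [h₂, Matrix.smul_mul, ← h₁, smul_smul, inv_mul_cancel₀ hdet, one_smul]
  have hAu : IsUnit A'.det := isUnit_iff_ne_zero.2 hdet
  have hXs : X = X'.submatrix id σ := by
    ext i j
    simp [hX']
  have hAs : A = A'.submatrix id σ := by
    ext i j
    simp [hA']
  have hmul : ∀ M : Matrix J J K, E * M.submatrix id σ = (E * M).submatrix id σ := fun M => rfl
  have hblocks := hasBlocks_diagonal_pencil ν hν (N := N) (by rw [hJ, hN])
  rw [← hJ, ← typeOfBlocks_jordan_vertical ν hν N]
  refine ⟨_, hblocks.leftPencil_of_equiv ((E * A').submatrix id σ)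
    ((A'⁻¹ * E').submatrix σ id) ?_ ?_ E E' hE hE' ?_ ?_, rfl⟩
  · rw [Matrix.submatrix_mul_equiv, Matrix.mul_assoc, ← Matrix.mul_assoc A',
      Matrix.mul_nonsing_inv _ hAu, Matrix.one_mul, hE, Matrix.submatrix_id_id]
  · have h₁ : A'⁻¹ * E' * (E * A') = 1 := by
      rw [Matrix.mul_assoc, ← Matrix.mul_assoc E', hE', Matrix.one_mul,
        Matrix.nonsing_inv_mul _ hAu]
    refine (Matrix.submatrix_mul_equiv _ _ σ (Equiv.refl J) σ).trans ?_
    rw [h₁, Matrix.submatrix_one_equiv]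
  · rw [hXs, hmul, hEX]
    rfl
  · rw [hAs, hmul, Matrix.one_mul]

end Square

/-! ### From the representations to the pencil of forms -/

section Representations

variable {K : Type*} [Field K]

theorem mem_so_iff {n : ℕ} {ξ : Matrix (Fin n) (Fin n) K} :
    ξ ∈ LieAlgebra.Orthogonal.so (Fin n) K ↔ ξ.transpose = -ξ :=
  LieAlgebra.Orthogonal.mem_so _ _ _

theorem orbitMap_soRep_apply {n m : ℕ} (x : Fin m → Fin n → K)
    (ξ : LieAlgebra.Orthogonal.so (Fin n) K) (i : Fin m) :
    orbitMap (soRep K n m) x ξ i = Matrix.mulVec ξ.1 (x i) := rfl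

theorem orbitMap_spRep_apply {k m : ℕ} (x : Fin m → Fin k ⊕ Fin k → K)
    (ξ : LieAlgebra.Symplectic.sp (Fin k) K) (i : Fin m) :
    orbitMap (spRep K k m) x ξ i = Matrix.mulVec ξ.1 (x i) := rfl

/-- Skew-symmetric matrices as elements of the orthogonal Lie algebra. -/
def skewEquivSo (K : Type*) [Field K] (n : ℕ) :
    epsSym K (-1) (Fin n) ≃ₗ[K] LieAlgebra.Orthogonal.so (Fin n) K where
  toFun S := ⟨S.1.transpose, by
    have h : S.1.transpose = -S.1 := by simpa using mem_epsSym_iff_transpose.1 S.2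
    rw [mem_so_iff, h, Matrix.transpose_neg, h]⟩
  map_add' S T := rfl
  map_smul' c S := rfl
  invFun ξ := ⟨ξ.1.transpose, by
    have h := mem_so_iff.1 ξ.2
    rw [mem_epsSym_iff_transpose, h, Matrix.transpose_neg, h]
    simp⟩
  left_inv S := rfl
  right_inv ξ := rfl

theorem mem_sp_iff {k : ℕ} {ξ : Matrix (Fin k ⊕ Fin k) (Fin k ⊕ Fin k) K} :
    ξ ∈ LieAlgebra.Symplectic.sp (Fin k) K ↔
      ξ.transpose * Matrix.J (Fin k) K = Matrix.J (Fin k) K * -ξ := by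
  rw [LieAlgebra.Symplectic.sp, mem_skewAdjointMatricesLieSubalgebra,
    mem_skewAdjointMatricesSubmodule]
  rfl

/-- Symmetric matrices as elements of the symplectic Lie algebra. -/
def symmEquivSp (K : Type*) [Field K] (k : ℕ) :
    epsSym K 1 (Fin k ⊕ Fin k) ≃ₗ[K] LieAlgebra.Symplectic.sp (Fin k) K where
  toFun S := ⟨-(Matrix.J (Fin k) K * S.1), by
    have hS : S.1.transpose = S.1 := by simpa using mem_epsSym_iff_transpose.1 S.2
    rw [mem_sp_iff, neg_neg, Matrix.transpose_neg, Matrix.transpose_mul, hS,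
      Matrix.J_transpose, Matrix.mul_neg, neg_neg, Matrix.mul_assoc, Matrix.J_squared,
      ← Matrix.mul_assoc, Matrix.J_squared]
    simp⟩
  map_add' S T := by ext1; simp [Matrix.mul_add]; abel
  map_smul' c S := by ext1; simp
  invFun ξ := ⟨Matrix.J (Fin k) K * ξ.1, by
    have h := mem_sp_iff.1 ξ.2
    rw [mem_epsSym_iff_transpose, Matrix.transpose_mul, Matrix.J_transpose, Matrix.mul_neg, h]
    simp⟩
  left_inv S := by
    ext1
    simp [← Matrix.mul_assoc, Matrix.J_squared]
  right_inv ξ := by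
    ext1
    simp [← Matrix.mul_assoc, Matrix.J_squared]

/-- Right multiplication by the matrix of the symplectic form. -/
def mulRightJ (K : Type*) [Field K] (k m : ℕ) :
    Matrix (Fin m) (Fin k ⊕ Fin k) K ≃ₗ[K] Matrix (Fin m) (Fin k ⊕ Fin k) K where
  toFun M := M * Matrix.J (Fin k) K
  map_add' M N := by simp [Matrix.add_mul]
  map_smul' c M := by simp
  invFun M := -(M * Matrix.J (Fin k) K)
  left_inv M := by simp [Matrix.mul_assoc, Matrix.J_squared]
  right_inv M := by simp [Matrix.mul_assoc, Matrix.J_squared]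

theorem isJKInvariant_soRep {n m : ℕ} {t : AlgebraicType}
    (h : HoldsGenerically K fun X A : Matrix (Fin m) (Fin n) K => ∃ s,
      HasBlocks (leftPencil (-1) X) (leftPencil (-1) A) s ∧ typeOfBlocks s = t) :
    IsJKInvariant (soRep K n m) t := by
  refine HoldsGenerically.genericPair (V := Fin m → Fin n → K) h fun x a hxa => ?_
  obtain ⟨s, hs, rfl⟩ := hxa
  have key : ∀ (y : Fin m → Fin n → K) (S : epsSym K (-1) (Fin n)),
      orbitMap (soRep K n m) y (skewEquivSo K n S) = leftPencil (J := Fin m) (-1) y S := by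
    intro y S
    funext i j
    rw [orbitMap_soRep_apply]
    change ∑ c, S.1 c j * y i c = ∑ c, y i c * S.1 c j
    exact Finset.sum_congr rfl fun c _ => mul_comm _ _
  exact (hs.of_equiv (V := Fin m → Fin n → K) (skewEquivSo K n)
    (LinearEquiv.refl K (Fin m → Fin n → K)) (key x) (key a)).hasAlgebraicType

/-- For `ξ = -J S` with `S` symmetric, `ξᵀ = S J`, so the orbit map is `leftPencil` followed by the
automorphism `mulRightJ`. -/
theorem isJKInvariant_spRep {k m : ℕ} {t : AlgebraicType}
    (h : HoldsGenerically K fun X A : Matrix (Fin m) (Fin k ⊕ Fin k) K => ∃ s,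
      HasBlocks (leftPencil 1 X) (leftPencil 1 A) s ∧ typeOfBlocks s = t) :
    IsJKInvariant (spRep K k m) t := by
  refine HoldsGenerically.genericPair (V := Fin m → Fin k ⊕ Fin k → K) h fun x a hxa => ?_
  obtain ⟨s, hs, rfl⟩ := hxa
  have key : ∀ (y : Fin m → Fin k ⊕ Fin k → K) (S : epsSym K 1 (Fin k ⊕ Fin k)),
      orbitMap (spRep K k m) y (symmEquivSp K k S) =
        mulRightJ K k m (leftPencil (J := Fin m) 1 y S) := by
    intro y S
    have hS : S.1.transpose = S.1 := by simpa using mem_epsSym_iff_transpose.1 S.2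
    have h₁ : (-(Matrix.J (Fin k) K * S.1)).transpose = S.1 * Matrix.J (Fin k) K := by
      rw [Matrix.transpose_neg, Matrix.transpose_mul, hS, Matrix.J_transpose, Matrix.mul_neg,
        neg_neg]
    have h₂ : mulRightJ K k m (leftPencil (J := Fin m) 1 y S) =
        (show Matrix (Fin m) (Fin k ⊕ Fin k) K from y) * (-(Matrix.J (Fin k) K * S.1)).transpose := by
      rw [h₁]
      exact Matrix.mul_assoc (l := Fin m) y S.1 (Matrix.J (Fin k) K)
    rw [h₂]
    funext i j
    rw [orbitMap_spRep_apply]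
    change ∑ c, (-(Matrix.J (Fin k) K * S.1)) j c * y i c =
      ∑ c, y i c * (-(Matrix.J (Fin k) K * S.1)) j c
    exact Finset.sum_congr rfl fun c _ => mul_comm _ _
  exact (hs.of_equiv (V := Fin m → Fin k ⊕ Fin k → K) (symmEquivSp K k)
    (mulRightJ K k m) (key x) (key a)).hasAlgebraicType

theorem two_mul_triangle_pred (a : ℕ) : 2 * ((a * (a - 1) / 2 : ℕ) : ℤ) = a * a - a := by
  have h := Nat.two_mul_div_two_of_even (Nat.even_mul_pred_self a)
  have h' : a * (a - 1) + a = a * a := by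
    cases a with
    | zero => rfl
    | succ a => simp; ring
  generalize a * (a - 1) / 2 = b at *
  generalize a * (a - 1) = c at *
  zify at h h'
  linarith

theorem two_mul_triangle_succ (a : ℕ) : 2 * ((a * (a + 1) / 2 : ℕ) : ℤ) = a * a + a := by
  have h := Nat.two_mul_div_two_of_even (Nat.even_mul_succ_self a)
  generalize a * (a + 1) / 2 = b at *
  zify at h
  linarith

end Representations

end JK

/-! ### The six cases and their index counts -/

theorem theoremT (K : Type*) [Field K] [IsAlgClosed K] [CharZero K] :
    -- the Lie algebra so(n), for which the sign is -1
    (∀ n m : ℕ,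
      (m < n → ∀ q r : ℕ, m = q * (n - m) + r → r < n - m →
        ∃ t : JK.AlgebraicType, JK.IsJKInvariant (JK.soRep K n m) t ∧
          t.horizontal =
            Multiset.replicate ((n - m - r) * (n - m - r - 1) / 2) (2 * q + 1) +
            Multiset.replicate ((n - m - r) * r) (2 * q + 2) +
            Multiset.replicate (r * (r - 1) / 2) (2 * q + 3) ∧
          t.horizontal.card = (n - m) * (n - m - 1) / 2 ∧
          t.vertical = Multiset.replicate (m * (m + 1) / 2) 2 ∧
          t.jordan = 0) ∧
      (m = n →
        ∃ t : JK.AlgebraicType, JK.IsJKInvariant (JK.soRep K n m) t ∧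
          t.horizontal = 0 ∧
          t.vertical = Multiset.replicate n 1 + Multiset.replicate (n * (n - 1) / 2) 2 ∧
          t.vertical.card = n * (n + 1) / 2 ∧
          t.jordan = 0) ∧
      (n < m →
        ∃ t : JK.AlgebraicType, JK.IsJKInvariant (JK.soRep K n m) t ∧
          t.horizontal = 0 ∧
          t.vertical =
            Multiset.replicate ((m - n + 1) * n) 1 + Multiset.replicate (n * (n - 1) / 2) 2 ∧
          t.vertical.card = n * (m - n) + n * (n + 1) / 2 ∧
          t.jordan = 0)) ∧
    -- the Lie algebra sp(n) with n = 2k, for which the sign is +1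
    (∀ n k m : ℕ, n = 2 * k →
      (m < n → ∀ q r : ℕ, m = q * (n - m) + r → r < n - m →
        ∃ t : JK.AlgebraicType, JK.IsJKInvariant (JK.spRep K k m) t ∧
          t.horizontal =
            Multiset.replicate ((n - m - r) * (n - m - r + 1) / 2) (2 * q + 1) +
            Multiset.replicate ((n - m - r) * r) (2 * q + 2) +
            Multiset.replicate (r * (r + 1) / 2) (2 * q + 3) ∧
          t.horizontal.card = (n - m) * (n - m + 1) / 2 ∧
          t.vertical = Multiset.replicate (m * (m - 1) / 2) 2 ∧
          t.jordan = 0) ∧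
      (m = n →
        ∃ t : JK.AlgebraicType, JK.IsJKInvariant (JK.spRep K k m) t ∧
          t.horizontal = 0 ∧
          t.vertical = Multiset.replicate (n * (n - 1) / 2) 2 ∧
          t.jordan = Multiset.replicate n {1}) ∧
      (n < m →
        ∃ t : JK.AlgebraicType, JK.IsJKInvariant (JK.spRep K k m) t ∧
          t.horizontal = 0 ∧
          t.vertical =
            Multiset.replicate ((m - n - 1) * n) 1 + Multiset.replicate (n * (n + 1) / 2) 2 ∧
          t.vertical.card = n * (m - n) + n * (n - 1) / 2 ∧
          t.jordan = 0)) := by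
  refine ⟨fun n m => ⟨fun hmn q r hm hr => ?_, fun hmn => ?_, fun hmn => ?_⟩,
    fun n k m hn => ⟨fun hmn q r hm hr => ?_, fun hmn => ?_, fun hmn => ?_⟩⟩
  · obtain ⟨p, rfl⟩ := Nat.exists_eq_add_of_le hmn.le
    rw [Nat.add_sub_cancel_left] at *
    -- Here `p = n - m` and `c = p - r` is the number of chains of length `q`; `r` chains have
    -- length `q + 1`.
    obtain ⟨c, rfl⟩ := Nat.exists_eq_add_of_le' hr.le
    rw [Nat.add_sub_cancel]
    have e₁ := JK.two_mul_triangle_pred c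
    have e₃ := JK.two_mul_triangle_pred r
    have e₄ := JK.two_mul_triangle_succ m
    have e₅ := JK.two_mul_triangle_pred (c + r)
    refine ⟨_, JK.isJKInvariant_soRep (JK.holdsGenerically_type_wide (-1) (by simp) (by simp)
      hm hr (N₁ := c * (c - 1) / 2) (N₂ := c * r) (N₃ := r * (r - 1) / 2) (N := m * (m + 1) / 2)
      ?_ ?_ ?_ ?_), rfl, ?_, rfl, rfl⟩
    · rw [e₁]; push_cast; ring
    · push_cast; ring
    · rw [e₃]; push_cast; ring
    · rw [e₄]; push_cast; ring
    · simp only [Multiset.card_add, Multiset.card_replicate]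
      generalize c * (c - 1) / 2 = N₁ at *
      generalize r * (r - 1) / 2 = N₃ at *
      generalize (c + r) * (c + r - 1) / 2 = N₅ at *
      zify
      push_cast at e₅ ⊢
      refine mul_left_cancel₀ (two_ne_zero (α := ℤ)) ?_
      linear_combination e₁ + e₃ - e₅
  · subst hmn
    have e₁ := JK.two_mul_triangle_pred m
    have e₂ := JK.two_mul_triangle_succ m
    refine ⟨_, JK.isJKInvariant_soRep (JK.holdsGenerically_type_tall (-1) le_rfl (Or.inl rfl)
      (N := m * (m - 1) / 2) (N' := m) ?_ ?_), rfl, add_comm _ _, ?_, rfl⟩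
    · rw [e₁, Fintype.card_fin]; push_cast; ring
    · rw [Fintype.card_fin]
      generalize m * (m - 1) / 2 = N₁ at *
      zify
      linear_combination e₁
    · simp only [Multiset.card_add, Multiset.card_replicate]
      generalize m * (m - 1) / 2 = N₁ at *
      generalize m * (m + 1) / 2 = N₂ at *
      zify
      refine mul_left_cancel₀ (two_ne_zero (α := ℤ)) ?_
      linear_combination e₁ - e₂
  · obtain ⟨l, rfl⟩ := Nat.exists_eq_add_of_le hmn.le
    rw [Nat.add_sub_cancel_left]
    have e₁ := JK.two_mul_triangle_pred n
    have e₂ := JK.two_mul_triangle_succ n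
    -- With `m = n + l`, the zero rows number `m n - n (n - 1) = (l + 1) n`.
    refine ⟨_, JK.isJKInvariant_soRep (JK.holdsGenerically_type_tall (-1) (by simp) (Or.inl rfl)
      (N := n * (n - 1) / 2) (N' := (l + 1) * n) ?_ ?_), rfl, add_comm _ _, ?_, rfl⟩
    · rw [e₁, Fintype.card_fin]; push_cast; ring
    · rw [Fintype.card_fin, Fintype.card_fin]
      generalize n * (n - 1) / 2 = N₁ at *
      zify
      linear_combination e₁
    · simp only [Multiset.card_add, Multiset.card_replicate]
      generalize n * (n - 1) / 2 = N₁ at *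
      generalize n * (n + 1) / 2 = N₂ at *
      zify
      refine mul_left_cancel₀ (two_ne_zero (α := ℤ)) ?_
      linear_combination e₁ - e₂
  · have hcard : Fintype.card (Fin k ⊕ Fin k) = n := by simp [hn, two_mul]
    obtain ⟨p, rfl⟩ := Nat.exists_eq_add_of_le hmn.le
    rw [Nat.add_sub_cancel_left] at *
    obtain ⟨c, rfl⟩ := Nat.exists_eq_add_of_le' hr.le
    rw [Nat.add_sub_cancel]
    have e₁ := JK.two_mul_triangle_succ c
    have e₃ := JK.two_mul_triangle_succ r
    have e₄ := JK.two_mul_triangle_pred m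
    have e₅ := JK.two_mul_triangle_succ (c + r)
    refine ⟨_, JK.isJKInvariant_spRep (JK.holdsGenerically_type_wide 1 (by simp) hcard
      hm hr (N₁ := c * (c + 1) / 2) (N₂ := c * r) (N₃ := r * (r + 1) / 2) (N := m * (m - 1) / 2)
      ?_ ?_ ?_ ?_), rfl, ?_, rfl, rfl⟩
    · rw [e₁]; push_cast; ring
    · push_cast; ring
    · rw [e₃]; push_cast; ring
    · rw [e₄]; push_cast; ring
    · simp only [Multiset.card_add, Multiset.card_replicate]
      generalize c * (c + 1) / 2 = N₁ at *
      generalize r * (r + 1) / 2 = N₃ at *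
      generalize (c + r) * (c + r + 1) / 2 = N₅ at *
      zify
      push_cast at e₁ e₃ e₅ ⊢
      refine mul_left_cancel₀ (two_ne_zero (α := ℤ)) ?_
      linear_combination e₁ + e₃ - e₅
  · have hcard : Fintype.card (Fin k ⊕ Fin k) = n := by simp [hn, two_mul]
    refine ⟨_, JK.isJKInvariant_spRep (JK.holdsGenerically_type_square hcard (by simp [hmn])
      (JK.two_mul_triangle_pred n)), rfl, rfl, rfl⟩
  · have hcard : Fintype.card (Fin k ⊕ Fin k) = n := by simp [hn, two_mul]
    -- Here `m = n + l + 1`, so `m - n - 1` is `l` and the zero rows number `m n - n (n + 1) = l n`.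
    obtain ⟨l, rfl⟩ := Nat.exists_eq_add_of_lt hmn
    rw [add_assoc, Nat.add_sub_cancel_left, Nat.add_sub_cancel]
    have e₁ := JK.two_mul_triangle_succ n
    have e₂ := JK.two_mul_triangle_pred n
    refine ⟨_, JK.isJKInvariant_spRep (JK.holdsGenerically_type_tall 1 (by simp [hcard])
      (Or.inr (by simp [hcard]))
      (N := n * (n + 1) / 2) (N' := l * n) ?_ ?_), rfl, add_comm _ _, ?_, rfl⟩
    · rw [e₁, hcard]; push_cast; ring
    · rw [Fintype.card_fin, hcard]
      generalize n * (n + 1) / 2 = N₁ at *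
      zify
      linear_combination e₁
    · simp only [Multiset.card_add, Multiset.card_replicate]
      generalize n * (n - 1) / 2 = N₁ at *
      generalize n * (n + 1) / 2 = N₂ at *
      zify
      refine mul_left_cancel₀ (two_ne_zero (α := ℤ)) ?_
      linear_combination e₁ - e₂
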